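/- Let $L\ge 1$ be an integer divisible by $3$, and let $\Lambda=\mathbb B/L\mathbb B$, where $\mathbb B$ is the triangular lattice generated by $\vec a_{1}=\frac12(3,\sqrt3)$, $\vec a_2=\frac12(3,-\sqrt3)$. Put $\vec b_{1}=\frac{2\pi}{3}(1,\sqrt3)$, $\vec b_2=\frac{2\pi}{3}(1,-\sqrt3)$ (dual basis), $\vec\delta_1=(1,0)$, $\vec\delta_{2}=\frac12(-1,\sqrt3)$, $\vec\delta_3=\frac12(-1,-\sqrt3)$, $\vec p_F^{\,+}=\big(\frac{2\pi}{3},\frac{2\pi}{3\sqrt3}\big)$, $\Lambda_A=\Lambda$, $\Lambda_B=\Lambda+\vec\delta_1$, and let $\mathcal A_\Lambda=\frac{3\sqrt3}{2}L^2$ be the area of $\Lambda$ and $|\Lambda|=L^2$. Electrons: for $\vec x\in\Lambda$ and $\sigma=\uparrow,\downarrow$ let $a^\pm_{\vec x,\sigma}$ and $b^\pm_{\vec x+\vec\delta_1,\sigma}$ be fermionic creation/annihilation operators on the sites of $\Lambda_A$ and $\Lambda_B$ (periodic boundary conditions, canonical anticommutation relations, fermionic Fock space), and let $n_{\vec x}$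 be the density operator at a site. Photons: let the momenta be $\underline p=\big(\vec p,p_3\big)=\big(\frac{n_1}{L}\vec b_1+\frac{n_2}{L}\vec b_2,\frac{2\pi n_3}{L}\big)\ne 0$, $n\in\mathbb Z^3$, and let $c^\pm_{\underline p,r}$, $r=1,2$, be bosonic creation/annihilation operators on the corresponding Fock space with $[c^-_{\underline p,r},c^+_{\underline p',r'}]=L\mathcal A_\Lambda\,\delta_{\underline p,\underline p'}\delta_{r,r'}$. Let $M>1$, $a_0>0$, $h^*\in\mathbb Z$ with $h^*<0$, let $\chi$ be a smooth function with $\chi(s)=1$ for $s\le a_0$ and $\chi(s)=0$ for $s\ge a_0M$, and suppose that $\chi_{[h^*,0]}(s):=\chi(s)-\chi(M^{-h^*}s)\ge 0$ for $s\ge0$. Let $\underline\varepsilon_{\underline p,r}\in\mathbb C^3$ satisfy $\underline\varepsilon^*_{\underline p,r}\cdot\underline\varepsilon_{\underline p,r'}=\delta_{r,r'}$ and $\underline\varepsilon_{\underline p,r}\cdot\underline p=0$. Set $$\underline A_{\underline y}=\frac1{\mathcal A_\Lambda L}\sum_{\underline p,r}\sqrt{\frac{\chi_{[h^*,0]}(|\underline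 p|)}{2|\underline p|}}\Big(\underline\varepsilon_{\underline p,r}c^-_{\underline p,r}e^{-i\underline p\cdot\underline y}+\underline\varepsilon^*_{\underline p,r}c^+_{\underline p,r}e^{i\underline p\cdot\underline y}\Big),\qquad A_{(\vec x,i)}=\int_0^1ds\,\vec\delta_i\cdot\vec A_{(\vec x+s\vec\delta_i,0)},$$ $$\varphi(\underline y)=\frac1{\mathcal A_\Lambda L}\sum_{\underline p}\frac{\chi_{[h^*,0]}(|\underline p|)}{|\underline p|^2}e^{-i\underline p\cdot\underline y},$$ and, for the charge $e\in\mathbb R$, $$\rho^{(E_+)}_{\vec x,i}=\sum_{\sigma=\uparrow,\downarrow}\Big(a^+_{\vec x,\sigma}b^-_{\vec x+\vec\delta_i,\sigma}e^{ieA_{(\vec x,i)}}+b^+_{\vec x+\vec\delta_i,\sigma}a^-_{\vec x,\sigma}e^{-ieA_{(\vec x,i)}}\Big),\qquad \hat\rho^{(E_+)}_{\vec k,i}=\sum_{\vec x\in\Lambda}e^{i\vec k\cdot\vec x}\rho^{(E_+)}_{\vec x,i}.$$ For a distortion $\phi=(\phi_{\vec x,i})_{\vec x\in\Lambda,\,i=1,2,3}$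 of real numbers and hopping parameter $t\in\mathbb R$, let $$\mathcal H_\Lambda(\{\phi\})=-\sum_{\vec x\in\Lambda}\sum_{i=1}^3(t+\phi_{\vec x,i})\rho^{(E_+)}_{\vec x,i}+\frac{e^2}2\sum_{\vec x,\vec y\in\Lambda_A\cup\Lambda_B}(n_{\vec x}-1)\varphi(\vec x-\vec y,0)(n_{\vec y}-1)+\frac1{L\mathcal A_\Lambda}\sum_{\underline p,r}|\underline p|\,c^+_{\underline p,r}c^-_{\underline p,r},$$ and, for $\beta>0$, let $\langle X\rangle^{\phi}_{\beta,L}=\mathrm{Tr}\big(e^{-\beta\mathcal H_\Lambda(\{\phi\})}X\big)\big/\mathrm{Tr}\,e^{-\beta\mathcal H_\Lambda(\{\phi\})}$. For $\phi_0,\Delta_0\in\mathbb R$ and $j_0\in\{1,2,3\}$ consider the Kekulé distortion $$\phi^{*,(j_0)}_{\vec x,i}=\phi_0+\tfrac23\Delta_0\cos\big(\vec p_F^{\,+}\cdot(\vec\delta_i-\vec\delta_{j_0}-\vec x)\big),$$ and write $\langle\cdot\rangle^{(j_0)}_{\beta,L}$ for the average in presence of $\phi^{*,(j_0)}$. Let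 $g\in\mathbb R$ and $\kappa>0$. Then the gap equation $$\phi^{*,(j_0)}_{\vec x,i}=\frac{g^2}{\kappa}\big\langle\rho^{(E_+)}_{\vec x,i}\big\rangle^{(j_0)}_{\beta,L}\qquad\text{for all }\vec x\in\Lambda,\ i=1,2,3,$$ holds if and only if the two equations $$\phi_0=\frac{g^2}{\kappa}\frac1{|\Lambda|}\big\langle\hat\rho^{(E_+)}_{\vec 0,1}\big\rangle^{(1)}_{\beta,L},\qquad \frac{\Delta_0}{3}=\frac{g^2}{\kappa}\frac1{|\Lambda|}\big\langle\hat\rho^{(E_+)}_{\vec p_F^{\,+},1}\big\rangle^{(1)}_{\beta,L}$$ hold. -/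

import Mathlib

open scoped BigOperators ContDiff

noncomputable section

namespace Honeycomb

/-! ### Geometry of the periodic honeycomb lattice -/

/-- Basis vectors of the triangular Bravais lattice. -/
def a₁ : Fin 2 → ℝ := ![3 / 2, √3 / 2]

def a₂ : Fin 2 → ℝ := ![3 / 2, -(√3 / 2)]

/-- Basis vectors of the dual lattice. -/
def b₁ : Fin 2 → ℝ := ![2 * Real.pi / 3, 2 * Real.pi / 3 * √3]

def b₂ : Fin 2 → ℝ := ![2 * Real.pi / 3, -(2 * Real.pi / 3 * √3)]

/-- The nearest neighbour vectors; the indices `0, 1, 2` stand for `1, 2, 3`. -/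
def δ : Fin 3 → (Fin 2 → ℝ) :=
  ![![1, 0], ![-(1 / 2), √3 / 2], ![-(1 / 2), -(√3 / 2)]]

/-- The Fermi point `p_F^+`. -/
def pF : Fin 2 → ℝ := ![2 * Real.pi / 3, 2 * Real.pi / (3 * √3)]

/-- The periodic triangular lattice `Λ = 𝔹 / L𝔹`: the pair `(m, n)` is the class of
`m a₁ + n a₂`. -/
abbrev Cell (L : ℕ) : Type := ZMod L × ZMod L

/-- The representative of a lattice point in the fundamental domain. -/
def cellPos {L : ℕ} (x : Cell L) : Fin 2 → ℝ :=
  (x.1.val : ℝ) • a₁ + (x.2.val : ℝ) • a₂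

/-- Sites of the honeycomb lattice: `(0, x)` is the `A` site `x`, `(1, x)` is the `B` site
`x + δ₁`. -/
abbrev Site (L : ℕ) : Type := Fin 2 × Cell L

def sitePos {L : ℕ} (s : Site L) : Fin 2 → ℝ :=
  if s.1 = 0 then cellPos s.2 else cellPos s.2 + δ 0

/-- The cell `y` with `x + δ_i = y + δ₁`; here `δ₂ - δ₁ = -a₂` and `δ₃ - δ₁ = -a₁`. -/
def neighbourCell {L : ℕ} (x : Cell L) (i : Fin 3) : Cell L :=
  (![x, (x.1, x.2 - 1), (x.1 - 1, x.2)] : Fin 3 → Cell L) i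

/-- The area of `Λ`. -/
def area (L : ℕ) : ℝ := (L : ℝ) ^ 2 * (3 * √3 / 2)

/-! ### Fermionic operators -/

section Fermions

variable {F : Type} [Fintype F] [DecidableEq F]

/-- The fermionic annihilation operator of the one-particle state `f` in the occupation number
basis (indexed by the finite set of occupied one-particle states), with Jordan-Wigner signs
with respect to an enumeration of the one-particle states. -/
def fermiAnn (f : F) : Matrix (Finset F) (Finset F) ℂ := fun S S' =>
  if f ∈ S' ∧ S = S'.erase f then
    (-1) ^ (S'.filter (fun g => Fintype.equivFin F g < Fintype.equivFin F f)).card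
  else 0

def fermiCre (f : F) : Matrix (Finset F) (Finset F) ℂ := (fermiAnn f).conjTranspose

end Fermions

/-- One-particle states of the electrons: a site and a spin. -/
abbrev Orbital (L : ℕ) : Type := Site L × Fin 2

/-- Occupation number configurations of the electrons. -/
abbrev FConf (L : ℕ) : Type := Finset (Orbital L)

/-! ### Photons -/

/-- Labels of the nonzero momenta of the photons (the mode of zero momentum has zero energy and
is not coupled to the electrons). -/
abbrev Momentum : Type := {n : ℤ × ℤ × ℤ // n ≠ 0}

/-- The planar part `(n₁/L) b₁ + (n₂/L) b₂` of a momentum. -/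
def planar (L : ℕ) (n : Momentum) : Fin 2 → ℝ :=
  ((n.1.1 : ℝ) / L) • b₁ + ((n.1.2.1 : ℝ) / L) • b₂

/-- The three-dimensional momentum, with third component `2π n₃ / L`. -/
def momentum (L : ℕ) (n : Momentum) : Fin 3 → ℝ :=
  ![planar L n 0, planar L n 1, 2 * Real.pi * (n.1.2.2 : ℝ) / L]

/-- The modulus of the three-dimensional momentum. -/
def absMomentum (L : ℕ) (n : Momentum) : ℝ := √(momentum L n ⬝ᵥ momentum L n)

/-- Photon modes: a momentum and a polarization label. -/
abbrev Mode : Type := Momentum × Fin 2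

/-- Occupation numbers of the photon modes. -/
abbrev Occ : Type := Mode →₀ ℕ

/-- The photon Fock space, in the occupation number representation. -/
abbrev PhotonSpace : Type := lp (fun _ : Occ => ℂ) 2

/-- The finite combinations of occupation number states. -/
abbrev PhotonCore : Type := Occ →₀ ℂ

/-- The inclusion of the finite combinations of occupation number states in Fock space. -/
def toFock : PhotonCore →ₗ[ℂ] PhotonSpace :=
  Finsupp.linearCombination ℂ (fun n : Occ => lp.single 2 n (1 : ℂ))

/-- The annihilation operator `c⁻`, normalized by `[c⁻, c⁺] = L 𝒜_Λ`. -/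
def photonAnn (L : ℕ) (m : Mode) : Module.End ℂ PhotonCore :=
  Finsupp.linearCombination ℂ (fun n : Occ =>
    Finsupp.single (n - Finsupp.single m 1) ((√(L * area L * (n m : ℝ)) : ℝ) : ℂ))

/-- The creation operator `c⁺`. -/
def photonCre (L : ℕ) (m : Mode) : Module.End ℂ PhotonCore :=
  Finsupp.linearCombination ℂ (fun n : Occ =>
    Finsupp.single (n + Finsupp.single m 1) ((√(L * area L * ((n m : ℝ) + 1)) : ℝ) : ℂ))

/-- `U` is the exponential `e^{iθA}`: it is a bounded operator given on the finite combinations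
of occupation number states by the exponential series. -/
def IsExpI (θ : ℝ) (A : Module.End ℂ PhotonCore) (U : PhotonSpace →L[ℂ] PhotonSpace) : Prop :=
  ∀ v : PhotonCore,
    HasSum (fun k : ℕ => ((Complex.I * θ) ^ k / (k.factorial : ℂ)) • toFock ((A ^ k) v))
      (U (toFock v))

open Classical in
/-- The operator `e^{iθA}`. It is used for `A` a finite linear combination of photon operators of
the form `f c⁻ + f̄ c⁺`; then it exists (the finite combinations of occupation number states are
analytic vectors of the symmetric operator `A`), is unique by density, and is unitary. -/
def expI (θ : ℝ) (A : Module.End ℂ PhotonCore) : PhotonSpace →L[ℂ] PhotonSpace :=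
  if h : ∃ U, IsExpI θ A U then h.choose else 0

/-- The energy `∑ |p| n_{p,r}` of an occupation number state, that is, the eigenvalue of
`(L 𝒜_Λ)⁻¹ ∑ |p| c⁺ c⁻`. -/
def photonEnergy (L : ℕ) (n : Occ) : ℝ := n.sum (fun m k => (k : ℝ) * absMomentum L m.1)

/-! ### The model -/

/-- The parameters of the model on the lattice of side `L`: hopping `t`, charge `e`, cutoff
function `χ` with its constants `a₀`, `M` and infrared scale `hstar`, polarization vectors `ε`. -/
structure Model (L : ℕ) where
  t : ℝ
  e : ℝ
  M : ℝ
  a₀ : ℝ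
  hstar : ℤ
  χ : ℝ → ℝ
  ε : Momentum → Fin 2 → (Fin 3 → ℂ)
  one_lt_M : 1 < M
  a₀_pos : 0 < a₀
  hstar_neg : hstar < 0
  χ_smooth : ContDiff ℝ ∞ χ
  χ_one : ∀ s, s ≤ a₀ → χ s = 1
  χ_zero : ∀ s, a₀ * M ≤ s → χ s = 0
  /-- Nonnegativity of `χ_{[h*,0]}`, of which the photon field contains the square root. -/
  χ_nonneg : ∀ s, 0 ≤ s → 0 ≤ χ s - χ (M ^ (-hstar) * s)
  ε_orthonormal : ∀ p r r', star (ε p r) ⬝ᵥ ε p r' = if r = r' then 1 else 0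
  ε_transverse : ∀ p r, ε p r ⬝ᵥ (fun k => (momentum L p k : ℂ)) = 0

namespace Model

variable {L : ℕ} (m : Model L)

/-- The cutoff `χ_{[h*,0]}(s) = χ(s) - χ(M^{-h*} s)`. -/
def cutoff (s : ℝ) : ℝ := m.χ s - m.χ (m.M ^ (-m.hstar) * s)

/-- The coefficient of `c⁻_{p,r}` in `A_{(x,i)} = ∫₀¹ ds δ_i · A_{(x + s δ_i, 0)}`. -/
def fieldCoeff (x : Cell L) (i : Fin 3) (p : Momentum) (r : Fin 2) : ℂ :=
  ((1 / (area L * L) * √(m.cutoff (absMomentum L p) / (2 * absMomentum L p)) : ℝ) : ℂ) *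
    ∫ s in (0 : ℝ)..1,
      ((δ i 0 : ℂ) * m.ε p r 0 + (δ i 1 : ℂ) * m.ε p r 1) *
        Complex.exp (-(Complex.I * ((planar L p ⬝ᵥ (cellPos x + s • δ i) : ℝ) : ℂ)))

/-- The integrated vector potential `A_{(x,i)}`; only finitely many momenta contribute. -/
def bondField (x : Cell L) (i : Fin 3) : Module.End ℂ PhotonCore :=
  ∑ᶠ p : Momentum, ∑ r : Fin 2,
    (m.fieldCoeff x i p r • photonAnn L (p, r) +
      star (m.fieldCoeff x i p r) • photonCre L (p, r))

/-- The regularized Coulomb potential `φ(y, 0)`; only finitely many momenta contribute. -/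
def coulomb (y : Fin 2 → ℝ) : ℂ :=
  ((1 / (area L * L) : ℝ) : ℂ) * ∑ᶠ p : Momentum,
    ((m.cutoff (absMomentum L p) / absMomentum L p ^ 2 : ℝ) : ℂ) *
      Complex.exp (-(Complex.I * ((planar L p ⬝ᵥ y : ℝ) : ℂ)))

end Model

/-- The Hilbert space (fermionic Fock space) ⊗ (photon Fock space). -/
abbrev Space (L : ℕ) : Type := PiLp 2 (fun _ : FConf L => PhotonSpace)

/-- Bounded operators on `Space L`, as matrices in the occupation numbers of the electrons with
entries the bounded operators on the photon Fock space. -/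
abbrev Obs (L : ℕ) : Type := Matrix (FConf L) (FConf L) (PhotonSpace →L[ℂ] PhotonSpace)

/-- The operator `X ⊗ U`. -/
def tensorOp {L : ℕ} (X : Matrix (FConf L) (FConf L) ℂ) (U : PhotonSpace →L[ℂ] PhotonSpace) :
    Obs L := X.map (fun z => z • U)

section Finite

variable {L : ℕ} [NeZero L]

/-- The action of a bounded operator on vectors. -/
def Obs.act (X : Obs L) : Space L →ₗ[ℂ] Space L where
  toFun ψ := WithLp.toLp 2 (fun S => ∑ S', X S S' (ψ S'))
  map_add' ψ ψ' := by
    ext1 S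
    simp [Finset.sum_add_distrib]
  map_smul' c ψ := by
    ext1 S
    simp [Finset.smul_sum]

/-- Annihilation and creation operators of the electrons at a site with given spin. -/
def ann (s : Site L) (σ : Fin 2) : Matrix (FConf L) (FConf L) ℂ := fermiAnn (s, σ)

def cre (s : Site L) (σ : Fin 2) : Matrix (FConf L) (FConf L) ℂ := fermiCre (s, σ)

/-- The density operator at a site. -/
def density (s : Site L) : Matrix (FConf L) (FConf L) ℂ := ∑ σ : Fin 2, cre s σ * ann s σ

namespace Model

variable (m : Model L)

/-- The bond operator `ρ^{(E₊)}_{x,i}`. -/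
def bondOp (x : Cell L) (i : Fin 3) : Obs L :=
  ∑ σ : Fin 2,
    (tensorOp (cre (0, x) σ * ann (1, neighbourCell x i) σ) (expI m.e (m.bondField x i)) +
      tensorOp (cre (1, neighbourCell x i) σ * ann (0, x) σ) (expI (-m.e) (m.bondField x i)))

/-- The Fourier transform `ρ̂^{(E₊)}_{k,i} = ∑_x e^{i k·x} ρ^{(E₊)}_{x,i}`. -/
def bondOpHat (k : Fin 2 → ℝ) (i : Fin 3) : Obs L :=
  ∑ x : Cell L, Complex.exp (Complex.I * ((k ⬝ᵥ cellPos x : ℝ) : ℂ)) • m.bondOp x i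

/-- The Coulomb energy
`(e²/2) ∑_{x,y ∈ Λ_A ∪ Λ_B} (n_x - 1) φ(x - y, 0) (n_y - 1)`. -/
def coulombEnergy : Matrix (FConf L) (FConf L) ℂ :=
  ((m.e ^ 2 / 2 : ℝ) : ℂ) • ∑ s : Site L, ∑ s' : Site L,
    m.coulomb (sitePos s - sitePos s') • ((density s - 1) * (density s' - 1))

/-- The bounded part of the Hamiltonian: the hopping term with hopping parameter
`t + φ_{x,i}` and the Coulomb energy. -/
def boundedPart (φ : Cell L → Fin 3 → ℝ) : Obs L :=
  -(∑ x : Cell L, ∑ i : Fin 3, ((m.t + φ x i : ℝ) : ℂ) • m.bondOp x i) +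
    tensorOp m.coulombEnergy (ContinuousLinearMap.id ℂ PhotonSpace)

end Model

variable (L) in
/-- The energy of the free photon field, a diagonal operator with its maximal domain. -/
def photonHamiltonian : Space L →ₗ.[ℂ] Space L where
  domain :=
    { carrier := {ψ | ∀ S, Memℓp (fun n : Occ => (photonEnergy L n : ℂ) * ψ S n) 2}
      add_mem' := by
        intro ψ ψ' h h' S
        convert (h S).add (h' S) using 1
        ext n
        simp [mul_add]
      zero_mem' := by
        intro S
        convert (zero_memℓp : Memℓp (0 : ∀ _ : Occ, ℂ) 2) using 1
        ext n
        simp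
      smul_mem' := by
        intro c ψ h S
        convert (h S).const_smul c using 1
        ext n
        simp [mul_left_comm] }
  toFun :=
    { toFun := fun ψ => WithLp.toLp 2 (fun S =>
        (⟨fun n : Occ => (photonEnergy L n : ℂ) * (ψ : Space L) S n, ψ.2 S⟩ : PhotonSpace))
      map_add' := by
        intro ψ ψ'
        ext S n
        simp [mul_add]
        rfl
      map_smul' := by
        intro c ψ
        ext S n
        simp [mul_left_comm] }

/-- The Hamiltonian `ℋ_Λ({φ})` in presence of the distortion `φ`, defined on the domain of the
free photon energy. -/
def Model.hamiltonian (m : Model L) (φ : Cell L → Fin 3 → ℝ) : Space L →ₗ.[ℂ] Space L where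
  domain := (photonHamiltonian L).domain
  toFun := (photonHamiltonian L).toFun +
    (m.boundedPart φ).act ∘ₗ (photonHamiltonian L).domain.subtype

end Finite

/-! ### Grand-canonical averages -/

section Gibbs

variable {V : Type} [NormedAddCommGroup V] [InnerProductSpace ℂ V]

/-- The eigenspace of the unbounded operator `H` for the real number `E`. -/
def eigenspace (H : V →ₗ.[ℂ] V) (E : ℝ) : Submodule ℂ V :=
  (LinearMap.ker (H.toFun - (E : ℂ) • H.domain.subtype)).map H.domain.subtype

open Classical in
/-- The trace of the compression of `X` to a finite-dimensional subspace. -/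
def traceOn (W : Submodule ℂ V) (X : V →ₗ[ℂ] V) : ℂ :=
  if h : FiniteDimensional ℂ W then
    haveI := h
    LinearMap.trace ℂ W (W.orthogonalProjectionOnto.toLinearMap ∘ₗ X ∘ₗ W.subtype)
  else 0

/-- `Tr (e^{-βH} X) = ∑_E e^{-βE} Tr (P_E X)`, with `P_E` the projection on the eigenspace of `E`.
It is used for `H` self-adjoint with compact resolvent (here: the free photon energy plus a
bounded symmetric operator), so that the eigenvectors of `H` span the space, the eigenspaces are
finite-dimensional, and this sum is the trace of `e^{-βH} X` in a basis of eigenvectors. -/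
def gibbsTrace (β : ℝ) (H : V →ₗ.[ℂ] V) (X : V →ₗ[ℂ] V) : ℂ :=
  ∑' E : ℝ, (Real.exp (-(β * E)) : ℂ) * traceOn (eigenspace H E) X

/-- The average `Tr (e^{-βH} X) / Tr e^{-βH}`. -/
def gibbsAverage (β : ℝ) (H : V →ₗ.[ℂ] V) (X : V →ₗ[ℂ] V) : ℂ :=
  gibbsTrace β H X / gibbsTrace β H LinearMap.id

end Gibbs

/-- The average `⟨X⟩^φ_{β,L}` in presence of the distortion `φ`. -/
def Model.average {L : ℕ} [NeZero L] (m : Model L) (β : ℝ) (φ : Cell L → Fin 3 → ℝ)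
    (X : Obs L) : ℂ :=
  gibbsAverage β (m.hamiltonian φ) X.act

/-- The Kekulé distortion `φ₀ + (2/3) Δ₀ cos(p_F^+ · (δ_i - δ_{j₀} - x))`. -/
def kekule {L : ℕ} (φ₀ Δ₀ : ℝ) (j₀ : Fin 3) (x : Cell L) (i : Fin 3) : ℝ :=
  φ₀ + 2 / 3 * Δ₀ * Real.cos (pF ⬝ᵥ (δ i - δ j₀ - cellPos x))

/-- The gap equation `φ_{x,i} = (g²/κ) ⟨ρ^{(E₊)}_{x,i}⟩^φ_{β,L}` for all `x`, `i`. -/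
def Model.GapEquation {L : ℕ} [NeZero L] (m : Model L) (β g κ : ℝ)
    (φ : Cell L → Fin 3 → ℝ) : Prop :=
  ∀ (x : Cell L) (i : Fin 3), (φ x i : ℂ) = (g ^ 2 / κ : ℝ) * m.average β φ (m.bondOp x i)

end Honeycomb

end

/-!
Translations of the lattice and the rotation by `2π/3` are implemented by unitary operators on
Fock space; on the photons they permute the momenta and rotate the two polarizations of each
momentum by a unitary matrix. They conjugate the Hamiltonian with one Kekulé distortion into the
Hamiltonian with another, so the average of a bond operator depends on the bond and on the label
of the distortion only through a class in `ℤ/3`, and it is real because the bond operators are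
symmetric. The distortion itself is `φ₀ + (2/3) Δ₀` on the class `0` and `φ₀ - Δ₀/3` on the two
others, so the gap equation consists of one equation for each class. Its Fourier transform on
`ℤ/3` consists of the mean and of the component at `p_F^+`, the component at `-p_F^+` being the
complex conjugate of the latter.

The averages are linear because the Gibbs weights are summable. Indeed, by Jensen's inequality
(Peierls), `∑ exp (-β E_k)` over orthonormal eigenvectors is bounded by the partition function of
the free photons times a constant depending on the norm of the bounded part of the Hamiltonian.
-/

noncomputable section

namespace Honeycomb

section GibbsTrace

variable {V V' : Type} [NormedAddCommGroup V] [InnerProductSpace ℂ V]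
  [NormedAddCommGroup V'] [InnerProductSpace ℂ V']

theorem mem_eigenspace {H : V →ₗ.[ℂ] V} {E : ℝ} {v : V} :
    v ∈ eigenspace H E ↔ ∃ h : v ∈ H.domain, H ⟨v, h⟩ = (E : ℂ) • v := by
  simp only [eigenspace, Submodule.mem_map, LinearMap.mem_ker, LinearMap.sub_apply,
    LinearMap.smul_apply, Submodule.subtype_apply, sub_eq_zero]
  constructor
  · rintro ⟨w, hw, rfl⟩
    exact ⟨w.2, hw⟩
  · rintro ⟨h, hv⟩
    exact ⟨⟨v, h⟩, hv, rfl⟩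

theorem isOrtho_eigenspace {H : V →ₗ.[ℂ] V} (hH : H.IsFormalAdjoint H) {E E' : ℝ} (hE : E ≠ E') :
    eigenspace H E ⟂ eigenspace H E' := by
  rw [Submodule.isOrtho_iff_inner_eq]
  intro v hv w hw
  obtain ⟨hv, hv_eq⟩ := mem_eigenspace.1 hv
  obtain ⟨hw, hw_eq⟩ := mem_eigenspace.1 hw
  have h := hH ⟨v, hv⟩ ⟨w, hw⟩
  rw [hv_eq, hw_eq, inner_smul_left, inner_smul_right, Complex.conj_ofReal] at h
  have hmul : ((E : ℂ) - E') * inner ℂ v w = 0 := by linear_combination h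
  exact (mul_eq_zero.1 hmul).resolve_left (sub_ne_zero.2 (Complex.ofReal_injective.ne hE))

theorem traceOn_of_not_finiteDimensional {W : Submodule ℂ V} (hW : ¬ FiniteDimensional ℂ W)
    (X : V →ₗ[ℂ] V) : traceOn W X = 0 := by
  rw [traceOn, dif_neg hW]

theorem traceOn_eq_sum_inner {ι : Type*} [Fintype ι] {W : Submodule ℂ V}
    (b : OrthonormalBasis ι ℂ W) (X : V →ₗ[ℂ] V) :
    traceOn W X = ∑ i, inner ℂ (b i : V) (X (b i)) := by
  have hW : FiniteDimensional ℂ W := b.toBasis.finiteDimensional_of_finite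
  rw [traceOn, dif_pos hW, LinearMap.trace_eq_sum_inner _ b]
  exact Finset.sum_congr rfl fun i _ => Submodule.inner_orthogonalProjectionOnto_eq_of_mem_left _ _

theorem traceOn_sum_smul {ι : Type*} (s : Finset ι) (W : Submodule ℂ V) (c : ι → ℂ)
    (X : ι → V →ₗ[ℂ] V) :
    traceOn W (∑ k ∈ s, c k • X k) = ∑ k ∈ s, c k * traceOn W (X k) := by
  by_cases hW : FiniteDimensional ℂ W
  · simp only [traceOn_eq_sum_inner (stdOrthonormalBasis ℂ W), LinearMap.sum_apply,
      LinearMap.smul_apply, inner_sum, inner_smul_right, Finset.mul_sum]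
    exact Finset.sum_comm
  · simp only [traceOn_of_not_finiteDimensional hW, mul_zero, Finset.sum_const_zero]

theorem conj_traceOn {W : Submodule ℂ V} {X : V →ₗ[ℂ] V} (hX : X.IsSymmetric) :
    (starRingEnd ℂ) (traceOn W X) = traceOn W X := by
  by_cases hW : FiniteDimensional ℂ W
  · rw [traceOn_eq_sum_inner (stdOrthonormalBasis ℂ W), map_sum]
    exact Finset.sum_congr rfl fun i _ => by rw [inner_conj_symm, hX]
  · rw [traceOn_of_not_finiteDimensional hW, map_zero]

theorem norm_traceOn_le {W : Submodule ℂ V} {X : V →ₗ[ℂ] V} {C : ℝ}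
    (hX : ∀ v : V, ‖v‖ = 1 → ‖inner ℂ v (X v)‖ ≤ C) :
    ‖traceOn W X‖ ≤ Module.finrank ℂ W * C := by
  by_cases hW : FiniteDimensional ℂ W
  · let b := stdOrthonormalBasis ℂ W
    rw [traceOn_eq_sum_inner b]
    refine (norm_sum_le_of_le _ fun i _ => hX (b i) (b.orthonormal.1 i)).trans_eq ?_
    rw [Finset.sum_const, Finset.card_univ, Fintype.card_fin, nsmul_eq_mul]
  · rw [traceOn_of_not_finiteDimensional hW, norm_zero, Module.finrank_of_not_finite hW,
      Nat.cast_zero, zero_mul]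

/-- The isometry `U` carries the unbounded operator `H` to `H'`, that is, `H' = U H U⁻¹`
including the equality of domains. -/
structure Intertwines (U : V ≃ₗᵢ[ℂ] V') (H : V →ₗ.[ℂ] V) (H' : V' →ₗ.[ℂ] V') : Prop where
  map_mem_domain_iff : ∀ v, U v ∈ H'.domain ↔ v ∈ H.domain
  apply_map : ∀ v (hv : v ∈ H.domain) (hv' : U v ∈ H'.domain), H' ⟨U v, hv'⟩ = U (H ⟨v, hv⟩)

theorem traceOn_map (U : V ≃ₗᵢ[ℂ] V') (W : Submodule ℂ V) {X : V →ₗ[ℂ] V} {X' : V' →ₗ[ℂ] V'}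
    (hX : ∀ v, U (X v) = X' (U v)) :
    traceOn (W.map (U.toLinearEquiv : V →ₗ[ℂ] V')) X' = traceOn W X := by
  by_cases hW : FiniteDimensional ℂ W
  · let b := stdOrthonormalBasis ℂ W
    rw [traceOn_eq_sum_inner b]
    refine (traceOn_eq_sum_inner (b.map (U.submoduleMap W)) X').trans ?_
    refine Finset.sum_congr rfl fun i _ => ?_
    have hb : ((b.map (U.submoduleMap W)) i : V') = U (b i) := by
      rw [OrthonormalBasis.map_apply, LinearIsometryEquiv.submoduleMap_apply_coe]
    rw [hb, ← hX, U.inner_map_map]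
  · have hW' : ¬ FiniteDimensional ℂ (W.map (U.toLinearEquiv : V →ₗ[ℂ] V')) := fun _ =>
      hW (LinearEquiv.finiteDimensional (U.toLinearEquiv.submoduleMap W).symm)
    rw [traceOn_of_not_finiteDimensional hW, traceOn_of_not_finiteDimensional hW']

namespace Intertwines

variable {U : V ≃ₗᵢ[ℂ] V'} {H : V →ₗ.[ℂ] V} {H' : V' →ₗ.[ℂ] V'} (hU : Intertwines U H H')
include hU

theorem eigenspace_eq_map (E : ℝ) :
    eigenspace H' E = (eigenspace H E).map (U.toLinearEquiv : V →ₗ[ℂ] V') := by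
  ext w
  obtain ⟨v, rfl⟩ := U.surjective w
  have hmap : U v ∈ (eigenspace H E).map (U.toLinearEquiv : V →ₗ[ℂ] V') ↔ v ∈ eigenspace H E :=
    U.injective.mem_set_image
  rw [hmap, mem_eigenspace, mem_eigenspace]
  constructor
  · rintro ⟨hv', heq⟩
    have hv := (hU.map_mem_domain_iff v).1 hv'
    exact ⟨hv, U.injective (by rw [← hU.apply_map v hv hv', heq, map_smul])⟩
  · rintro ⟨hv, heq⟩
    exact ⟨(hU.map_mem_domain_iff v).2 hv, by rw [hU.apply_map v hv, heq, map_smul]⟩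

theorem gibbsTrace_eq {X : V →ₗ[ℂ] V} {X' : V' →ₗ[ℂ] V'} (hX : ∀ v, U (X v) = X' (U v)) (β : ℝ) :
    gibbsTrace β H' X' = gibbsTrace β H X := by
  simp only [gibbsTrace, hU.eigenspace_eq_map, traceOn_map U _ hX]

theorem gibbsAverage_eq {X : V →ₗ[ℂ] V} {X' : V' →ₗ[ℂ] V'} (hX : ∀ v, U (X v) = X' (U v))
    (β : ℝ) : gibbsAverage β H' X' = gibbsAverage β H X := by
  rw [gibbsAverage, gibbsAverage, hU.gibbsTrace_eq hX,
    hU.gibbsTrace_eq (X := LinearMap.id) (X' := LinearMap.id) fun _ => rfl]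

end Intertwines

theorem gibbsAverage_sum_smul {ι : Type*} (s : Finset ι) {β : ℝ} {H : V →ₗ.[ℂ] V} (c : ι → ℂ)
    (X : ι → V →ₗ[ℂ] V)
    (hX : ∀ k ∈ s, Summable fun E : ℝ =>
      (Real.exp (-(β * E)) : ℂ) * traceOn (eigenspace H E) (X k)) :
    gibbsAverage β H (∑ k ∈ s, c k • X k) = ∑ k ∈ s, c k * gibbsAverage β H (X k) := by
  have htrace : gibbsTrace β H (∑ k ∈ s, c k • X k) = ∑ k ∈ s, c k * gibbsTrace β H (X k) := by
    simp only [gibbsTrace, traceOn_sum_smul, ← tsum_mul_left]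
    rw [← Summable.tsum_finsetSum fun k hk => (hX k hk).mul_left (c k)]
    refine tsum_congr fun E => ?_
    rw [Finset.mul_sum]
    exact Finset.sum_congr rfl fun k _ => mul_left_comm _ _ _
  simp only [gibbsAverage, htrace, Finset.sum_div, mul_div_assoc]

theorem conj_gibbsTrace {β : ℝ} {H : V →ₗ.[ℂ] V} {X : V →ₗ[ℂ] V} (hX : X.IsSymmetric) :
    (starRingEnd ℂ) (gibbsTrace β H X) = gibbsTrace β H X := by
  rw [gibbsTrace, Complex.conj_tsum]
  exact tsum_congr fun E => by rw [map_mul, conj_traceOn hX, Complex.conj_ofReal]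

theorem conj_gibbsAverage {β : ℝ} {H : V →ₗ.[ℂ] V} {X : V →ₗ[ℂ] V} (hX : X.IsSymmetric) :
    (starRingEnd ℂ) (gibbsAverage β H X) = gibbsAverage β H X := by
  rw [gibbsAverage, map_div₀, conj_gibbsTrace hX, conj_gibbsTrace LinearMap.IsSymmetric.id]

theorem exists_orthonormal_fin_finrank (W : Submodule ℂ V) :
    ∃ v : Fin (Module.finrank ℂ W) → W, Orthonormal ℂ v := by
  by_cases hW : FiniteDimensional ℂ W
  · exact ⟨_, (stdOrthonormalBasis ℂ W).orthonormal⟩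
  · rw [Module.finrank_of_not_finite hW]
    exact ⟨Fin.elim0, fun i => i.elim0, fun i => i.elim0⟩

section GibbsWeights

variable {β K : ℝ} {H : V →ₗ.[ℂ] V} (hH : H.IsFormalAdjoint H)
  (hK : ∀ (ι : Type) [Fintype ι] (v : ι → V) (E : ι → ℝ), Orthonormal ℂ v →
    (∀ k, v k ∈ eigenspace H (E k)) → ∑ k, Real.exp (-(β * E k)) ≤ K)
include hH hK

theorem sum_finrank_eigenspace_mul_exp_le (s : Finset ℝ) :
    ∑ E ∈ s, Module.finrank ℂ (eigenspace H E) * Real.exp (-(β * E)) ≤ K := by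
  choose b hb using fun E : s => exists_orthonormal_fin_finrank (eigenspace H E)
  have hfamily : OrthogonalFamily ℂ (fun E : s => eigenspace H E)
      fun E : s => (eigenspace H (E : ℝ)).subtypeₗᵢ :=
    orthogonalFamily_iff_pairwise.2 fun E E' hne => isOrtho_eigenspace hH (Subtype.coe_ne_coe.2 hne)
  have hsum := hK (Σ E : s, Fin (Module.finrank ℂ (eigenspace H (E : ℝ))))
    (fun k => (b k.1 k.2 : V)) (fun k => (k.1 : ℝ))
    (hfamily.orthonormal_sigma_orthonormal (v_family := b) hb) fun k => (b k.1 k.2).2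
  simpa only [Fintype.sum_sigma, Finset.sum_const, Finset.card_univ, Fintype.card_fin,
    nsmul_eq_mul, ← Finset.sum_coe_sort s] using hsum

theorem summable_gibbsTrace {X : V →ₗ[ℂ] V} {C : ℝ}
    (hX : ∀ v : V, ‖v‖ = 1 → ‖inner ℂ v (X v)‖ ≤ C) :
    Summable fun E : ℝ => (Real.exp (-(β * E)) : ℂ) * traceOn (eigenspace H E) X := by
  refine Summable.of_norm (summable_of_sum_le (c := K * |C|) (fun _ => norm_nonneg _) fun s => ?_)
  calc ∑ E ∈ s, ‖(Real.exp (-(β * E)) : ℂ) * traceOn (eigenspace H E) X‖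
      ≤ ∑ E ∈ s, Module.finrank ℂ (eigenspace H E) * Real.exp (-(β * E)) * |C| := by
        refine Finset.sum_le_sum fun E _ => ?_
        rw [norm_mul, Complex.norm_real, Real.norm_of_nonneg (Real.exp_nonneg _), mul_right_comm,
          mul_comm]
        gcongr
        exact norm_traceOn_le fun v hv => (hX v hv).trans (le_abs_self C)
    _ ≤ K * |C| := by
        rw [← Finset.sum_mul]
        exact mul_le_mul_of_nonneg_right (sum_finrank_eigenspace_mul_exp_le hH hK s) (abs_nonneg C)

end GibbsWeights

end GibbsTrace

section PartitionFunction

theorem sum_finsupp_prod {ι α R : Type*} [Zero α] [CommSemiring R] (s : Finset ι)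
    (t : ι → Finset α) (f : ι → α → R) (hf : ∀ i, f i 0 = 1) :
    ∑ n ∈ s.finsupp t, n.prod f = ∏ i ∈ s, ∑ k ∈ t i, f i k := by
  classical
  rw [Finset.finsupp, Finset.sum_map, Finset.prod_sum]
  refine Finset.sum_congr rfl fun p _ => ?_
  change (Finsupp.indicator s p).prod f = _
  rw [Finsupp.prod_of_support_subset (s := s) _ (Finsupp.support_indicator_subset s _) _
    (fun i _ => hf i), ← Finset.prod_attach]
  exact Finset.prod_congr rfl fun i _ => by rw [Finsupp.indicator_of_mem i.2]

theorem sum_pow_le_exp_div {q r : ℝ} (h0 : 0 ≤ q) (hq : q ≤ r) (hr : r < 1) (s : Finset ℕ) :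
    ∑ k ∈ s, q ^ k ≤ Real.exp (q / (1 - r)) := by
  have hq1 : q < 1 := hq.trans_lt hr
  calc ∑ k ∈ s, q ^ k ≤ ∑' k, q ^ k :=
        (summable_geometric_of_lt_one h0 hq1).sum_le_tsum _ fun k _ => pow_nonneg h0 k
    _ = q / (1 - q) + 1 := by
        rw [tsum_geometric_of_lt_one h0 hq1]
        field_simp [(sub_pos.2 hq1).ne']
        ring
    _ ≤ q / (1 - r) + 1 := by
        gcongr
    _ ≤ Real.exp (q / (1 - r)) := Real.add_one_le_exp _

theorem summable_finsupp_prod_pow {ι : Type*} {q : ι → ℝ} {r : ℝ} (h0 : ∀ i, 0 ≤ q i)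
    (hr : r < 1) (hq : ∀ i, q i ≤ r) (hs : Summable q) :
    Summable fun n : ι →₀ ℕ => n.prod fun i k => q i ^ k := by
  classical
  have hnonneg : ∀ n : ι →₀ ℕ, 0 ≤ n.prod fun i k => q i ^ k := fun n =>
    Finset.prod_nonneg fun i _ => pow_nonneg (h0 i) _
  refine summable_of_sum_le (c := Real.exp ((∑' i, q i) / (1 - r))) hnonneg fun T => ?_
  let N : ι →₀ ℕ := T.sup id
  have hT : T ⊆ N.support.finsupp fun i => Finset.Iic (N i) := fun n hn => by
    have hle : n ≤ N := Finset.le_sup (f := id) hn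
    exact Finset.mem_finsupp_iff.2
      ⟨Finsupp.support_mono hle, fun i _ => Finset.mem_Iic.2 (hle i)⟩
  calc ∑ n ∈ T, (n.prod fun i k => q i ^ k)
      ≤ ∑ n ∈ N.support.finsupp fun i => Finset.Iic (N i), (n.prod fun i k => q i ^ k) :=
        Finset.sum_le_sum_of_subset_of_nonneg hT fun n _ _ => hnonneg n
    _ = ∏ i ∈ N.support, ∑ k ∈ Finset.Iic (N i), q i ^ k :=
        sum_finsupp_prod _ _ _ fun i => pow_zero _
    _ ≤ ∏ i ∈ N.support, Real.exp (q i / (1 - r)) :=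
        Finset.prod_le_prod (fun i _ => Finset.sum_nonneg fun k _ => pow_nonneg (h0 i) k)
          fun i _ => sum_pow_le_exp_div (h0 i) (hq i) hr _
    _ = Real.exp ((∑ i ∈ N.support, q i) / (1 - r)) := by rw [← Real.exp_sum, Finset.sum_div]
    _ ≤ Real.exp ((∑' i, q i) / (1 - r)) := Real.exp_le_exp.2
        (div_le_div_of_nonneg_right (hs.sum_le_tsum _ fun i _ => h0 i) (sub_pos.2 hr).le)

theorem summable_exp_neg_mul_abs_int {c : ℝ} (hc : 0 < c) :
    Summable fun k : ℤ => Real.exp (-(c * |(k : ℝ)|)) := by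
  have hnat : Summable fun k : ℕ => Real.exp (-(c * (k : ℝ))) :=
    ((Real.summable_exp_nat_mul_iff (a := -c)).2 (neg_lt_zero.2 hc)).congr fun k => by
      rw [mul_neg, mul_comm]
  refine Summable.of_nat_of_neg ?_ ?_ <;> simpa using hnat

theorem momentum_dotProduct_self (L : ℕ) (n : Momentum) :
    momentum L n ⬝ᵥ momentum L n = (2 * Real.pi / (3 * L)) ^ 2 *
      (4 * (n.1.1 : ℝ) ^ 2 + 4 * (n.1.2.1 : ℝ) ^ 2 - 4 * n.1.1 * n.1.2.1
        + 9 * (n.1.2.2 : ℝ) ^ 2) := by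
  have hsqrt : √3 ^ 2 = (3 : ℝ) := Real.sq_sqrt (by norm_num)
  simp only [momentum, planar, b₁, b₂, dotProduct, Fin.sum_univ_three, Matrix.cons_val_zero,
    Matrix.cons_val_one, Matrix.cons_val, Pi.add_apply, Pi.smul_apply, smul_eq_mul]
  linear_combination (2 * Real.pi / (3 * L)) ^ 2 * ((n.1.1 : ℝ) - n.1.2.1) ^ 2 * hsqrt

theorem mul_sum_abs_le_absMomentum (L : ℕ) (n : Momentum) :
    Real.pi / (3 * L) * (|(n.1.1 : ℝ)| + |(n.1.2.1 : ℝ)| + |(n.1.2.2 : ℝ)|)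
      ≤ absMomentum L n := by
  refine Real.le_sqrt_of_sq_le ?_
  have hfactor : (2 * Real.pi / (3 * L)) ^ 2 = (Real.pi / (3 * L)) ^ 2 * 4 := by ring
  rw [momentum_dotProduct_self, mul_pow, hfactor, mul_assoc]
  refine mul_le_mul_of_nonneg_left ?_ (sq_nonneg _)
  generalize (n.1.1 : ℝ) = x, (n.1.2.1 : ℝ) = y, (n.1.2.2 : ℝ) = z
  nlinarith [sq_abs x, sq_abs y, sq_abs z, sq_nonneg (x - y), sq_nonneg (|x| - |y|),
    sq_nonneg (|x| - |z|), sq_nonneg (|y| - |z|)]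

theorem pi_div_le_absMomentum (L : ℕ) (n : Momentum) : Real.pi / (3 * L) ≤ absMomentum L n := by
  refine le_trans (le_mul_of_one_le_right (by positivity) ?_) (mul_sum_abs_le_absMomentum L n)
  have hne : ¬ (n.1.1 = 0 ∧ n.1.2.1 = 0 ∧ n.1.2.2 = 0) := fun h =>
    n.2 (Prod.ext h.1 (Prod.ext h.2.1 h.2.2))
  have hone : 1 ≤ |n.1.1| + |n.1.2.1| + |n.1.2.2| := by
    simp only [abs_eq_max_neg]
    omega
  exact_mod_cast hone

theorem exp_neg_photonEnergy (L : ℕ) (β : ℝ) (n : Occ) : Real.exp (-(β * photonEnergy L n)) =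
    n.prod fun m k => Real.exp (-(β * absMomentum L m.1)) ^ k := by
  rw [photonEnergy, Finsupp.sum, Finset.mul_sum, ← Finset.sum_neg_distrib, Real.exp_sum,
    Finsupp.prod]
  refine Finset.prod_congr rfl fun m _ => ?_
  rw [← Real.exp_nat_mul]
  congr 1
  ring

variable {L : ℕ} [NeZero L]

theorem absMomentum_pos (n : Momentum) : 0 < absMomentum L n := by
  have hL : 0 < (L : ℝ) := Nat.cast_pos.2 (NeZero.pos L)
  exact lt_of_lt_of_le (by positivity) (pi_div_le_absMomentum L n)

theorem summable_exp_neg_absMomentum {β : ℝ} (hβ : 0 < β) :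
    Summable fun n : Momentum => Real.exp (-(β * absMomentum L n)) := by
  have hL : 0 < (L : ℝ) := Nat.cast_pos.2 (NeZero.pos L)
  have hcoord := summable_exp_neg_mul_abs_int (c := β * (Real.pi / (3 * L))) (by positivity)
  have hpair := hcoord.mul_of_nonneg hcoord (fun _ => Real.exp_nonneg _) fun _ => Real.exp_nonneg _
  have htriple := hcoord.mul_of_nonneg hpair (fun _ => Real.exp_nonneg _)
    fun _ => mul_nonneg (Real.exp_nonneg _) (Real.exp_nonneg _)
  refine Summable.of_nonneg_of_le (fun _ => Real.exp_nonneg _) (fun n => ?_)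
    (htriple.comp_injective (Subtype.val_injective (p := fun n : ℤ × ℤ × ℤ => n ≠ 0)))
  simp only [Function.comp_apply, ← Real.exp_add]
  refine Real.exp_le_exp.2 ?_
  have := mul_le_mul_of_nonneg_left (mul_sum_abs_le_absMomentum L n) hβ.le
  linarith

variable (L) in
theorem summable_exp_neg_photonEnergy {β : ℝ} (hβ : 0 < β) :
    Summable fun n : Occ => Real.exp (-(β * photonEnergy L n)) := by
  have hL : 0 < (L : ℝ) := Nat.cast_pos.2 (NeZero.pos L)
  have hmodes : Summable fun m : Mode => Real.exp (-(β * absMomentum L m.1)) := by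
    simpa only [mul_one] using (summable_exp_neg_absMomentum (L := L) hβ).mul_of_nonneg
      (g := fun _ : Fin 2 => (1 : ℝ)) Summable.of_finite (fun _ => Real.exp_nonneg _)
      fun _ => zero_le_one
  simp only [exp_neg_photonEnergy]
  refine summable_finsupp_prod_pow (r := Real.exp (-(β * (Real.pi / (3 * L)))))
    (fun _ => Real.exp_nonneg _) ?_ (fun m => ?_) hmodes
  · rw [Real.exp_lt_one_iff, neg_lt_zero]
    positivity
  · gcongr
    exact pi_div_le_absMomentum L m.1

end PartitionFunction

section PhotonCoreOperators

theorem toFock_single (n : Occ) (c : ℂ) : toFock (Finsupp.single n c) = lp.single 2 n c := by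
  rw [toFock, Finsupp.linearCombination_single, ← lp.single_smul, smul_eq_mul, mul_one]

theorem inner_toFock_single (n : Occ) (c : ℂ) (ψ : PhotonSpace) :
    inner ℂ (toFock (Finsupp.single n c)) ψ = (starRingEnd ℂ) c * ψ n := by
  rw [toFock_single, lp.inner_single_left]
  simp [mul_comm]

theorem toFock_apply (f : PhotonCore) (n : Occ) : toFock f n = f n := by
  induction f using Finsupp.induction_linear with
  | zero => simp
  | add f g hf hg => simp [hf, hg]
  | single k c =>
    rw [toFock_single]
    by_cases h : k = n
    · subst h; simp
    · rw [Finsupp.single_eq_of_ne (Ne.symm h), lp.single_apply_ne _ _ _ (Ne.symm h)]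

theorem eq_of_inner_toFock {ψ ψ' : PhotonSpace}
    (h : ∀ f : PhotonCore, inner ℂ (toFock f) ψ = inner ℂ (toFock f) ψ') : ψ = ψ' := by
  ext n
  simpa [inner_toFock_single] using h (Finsupp.single n 1)

theorem ext_of_toFock {U U' : PhotonSpace →L[ℂ] PhotonSpace}
    (h : ∀ f : PhotonCore, U (toFock f) = U' (toFock f)) : U = U' := by
  ext1 ψ
  have hs := lp.hasSum_single (p := 2) (by norm_num) ψ
  refine (hs.mapL U).unique ?_
  convert hs.mapL U' using 2 with n
  simpa only [toFock_single] using h (Finsupp.single n (ψ n))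

theorem photonCre_single (L : ℕ) (m : Mode) (n : Occ) (c : ℂ) :
    photonCre L m (Finsupp.single n c) = Finsupp.single (n + Finsupp.single m 1)
      (c * ((√(L * area L * ((n m : ℝ) + 1)) : ℝ) : ℂ)) := by
  rw [photonCre, Finsupp.linearCombination_single, Finsupp.smul_single, smul_eq_mul]

theorem photonAnn_single (L : ℕ) (m : Mode) (n : Occ) (c : ℂ) :
    photonAnn L m (Finsupp.single n c) = Finsupp.single (n - Finsupp.single m 1)
      (c * ((√(L * area L * (n m : ℝ)) : ℝ) : ℂ)) := by
  rw [photonAnn, Finsupp.linearCombination_single, Finsupp.smul_single, smul_eq_mul]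

theorem exists_add_single_of_ne_zero {n : Occ} {m : Mode} (h : n m ≠ 0) :
    ∃ k : Occ, n = k + Finsupp.single m 1 :=
  ⟨n - Finsupp.single m 1, (tsub_add_cancel_of_le
    (Finsupp.single_le_iff.2 (Nat.one_le_iff_ne_zero.2 h))).symm⟩

theorem inner_photonCre (L : ℕ) (m : Mode) (f g : PhotonCore) :
    inner ℂ (toFock (photonCre L m f)) (toFock g) =
      inner ℂ (toFock f) (toFock (photonAnn L m g)) := by
  induction f using Finsupp.induction_linear with
  | zero => simp
  | add f f' hf hf' => simp only [map_add, inner_add_left, hf, hf']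
  | single n c =>
    induction g using Finsupp.induction_linear with
    | zero => simp
    | add g g' hg hg' => simp only [map_add, inner_add_right, hg, hg']
    | single k d =>
      rw [photonCre_single, photonAnn_single, inner_toFock_single, inner_toFock_single,
        toFock_apply, toFock_apply]
      by_cases hk : k m = 0
      · have hne : n + Finsupp.single m 1 ≠ k := by
          rintro rfl
          simp at hk
        simp [Finsupp.single_eq_of_ne hne, hk]
      · obtain ⟨k, rfl⟩ := exists_add_single_of_ne_zero hk
        rw [add_tsub_cancel_right]
        by_cases hn : k = n
        · subst hn
          simp only [Finsupp.single_eq_same, Finsupp.add_apply, map_mul, Complex.conj_ofReal,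
            Nat.cast_add, Nat.cast_one]
          ring
        · rw [Finsupp.single_eq_of_ne (Ne.symm hn),
            Finsupp.single_eq_of_ne fun h => hn (add_right_cancel h).symm, mul_zero, mul_zero]

theorem inner_photonAnn (L : ℕ) (m : Mode) (f g : PhotonCore) :
    inner ℂ (toFock (photonAnn L m f)) (toFock g) =
      inner ℂ (toFock f) (toFock (photonCre L m g)) := by
  rw [← inner_conj_symm, ← inner_photonCre, inner_conj_symm]

/-- Symmetry of an operator defined on the finite combinations of occupation number states, with
respect to the inner product of Fock space. -/
def IsCoreSymmetric (A : Module.End ℂ PhotonCore) : Prop :=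
  ∀ f g, inner ℂ (toFock (A f)) (toFock g) = inner ℂ (toFock f) (toFock (A g))

theorem isCoreSymmetric_zero : IsCoreSymmetric 0 := fun f g => by simp

theorem IsCoreSymmetric.add {A B : Module.End ℂ PhotonCore} (hA : IsCoreSymmetric A)
    (hB : IsCoreSymmetric B) : IsCoreSymmetric (A + B) := fun f g => by
  simp only [LinearMap.add_apply, map_add, inner_add_left, inner_add_right, hA f g, hB f g]

theorem isCoreSymmetric_photonAnn_add_photonCre (L : ℕ) (m : Mode) (c : ℂ) :
    IsCoreSymmetric (c • photonAnn L m + star c • photonCre L m) := fun f g => by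
  simp only [LinearMap.add_apply, LinearMap.smul_apply, map_add, map_smul, inner_add_left,
    inner_add_right, inner_smul_left, inner_smul_right, inner_photonAnn, inner_photonCre]
  simp only [starRingEnd_apply, star_star]
  exact add_comm _ _

theorem IsCoreSymmetric.pow {A : Module.End ℂ PhotonCore} (hA : IsCoreSymmetric A) (k : ℕ) :
    IsCoreSymmetric (A ^ k) := by
  induction k with
  | zero => exact fun f g => by simp
  | succ k ih =>
    intro f g
    rw [pow_succ, Module.End.mul_apply, ih, hA, ← Module.End.mul_apply, ← pow_succ', pow_succ]

theorem Model.isCoreSymmetric_bondField {L : ℕ} (m : Model L) (x : Cell L) (i : Fin 3) :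
    IsCoreSymmetric (m.bondField x i) := by
  refine finsum_induction (p := IsCoreSymmetric) isCoreSymmetric_zero
    (fun _ _ hA hB => hA.add hB) fun p => ?_
  rw [Fin.sum_univ_two]
  exact (isCoreSymmetric_photonAnn_add_photonCre _ _ _).add
    (isCoreSymmetric_photonAnn_add_photonCre _ _ _)

end PhotonCoreOperators

section Exponentials

theorem IsExpI.unique {θ : ℝ} {A : Module.End ℂ PhotonCore} {U U' : PhotonSpace →L[ℂ] PhotonSpace}
    (hU : IsExpI θ A U) (hU' : IsExpI θ A U') : U = U' :=
  ext_of_toFock fun f => (hU f).unique (hU' f)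

theorem IsExpI.expI_eq {θ : ℝ} {A : Module.End ℂ PhotonCore} {U : PhotonSpace →L[ℂ] PhotonSpace}
    (hU : IsExpI θ A U) : expI θ A = U := by
  have hex : ∃ U, IsExpI θ A U := ⟨U, hU⟩
  rw [expI, dif_pos hex]
  exact hex.choose_spec.unique hU

theorem expI_eq_zero {θ : ℝ} {A : Module.End ℂ PhotonCore} (h : ¬ ∃ U, IsExpI θ A U) :
    expI θ A = 0 := by
  rw [expI, dif_neg h]

theorem summable_neg_one_pow_smul {E : Type*} [NormedAddCommGroup E] [NormedSpace ℂ E]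
    [CompleteSpace E] {u : ℕ → E} (hu : Summable u) : Summable fun k => (-1 : ℂ) ^ k • u k := by
  refine (((hu.indicator {k | Even k}).const_smul (2 : ℂ)).sub hu).congr fun k => ?_
  by_cases hk : Even k
  · rw [Set.indicator_of_mem (show k ∈ {k | Even k} from hk), hk.neg_one_pow, two_smul,
      add_sub_cancel_right, one_smul]
  · rw [Set.indicator_of_notMem (show k ∉ {k | Even k} from hk),
      (Nat.not_even_iff_odd.1 hk).neg_one_pow, smul_zero, zero_sub, neg_one_smul]

theorem IsExpI.summable_neg {θ : ℝ} {A : Module.End ℂ PhotonCore}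
    {U : PhotonSpace →L[ℂ] PhotonSpace} (hU : IsExpI θ A U) (f : PhotonCore) :
    Summable fun k : ℕ =>
      ((Complex.I * (-θ : ℝ)) ^ k / (k.factorial : ℂ)) • toFock ((A ^ k) f) := by
  refine (summable_neg_one_pow_smul (hU f).summable).congr fun k => ?_
  rw [smul_smul, ← mul_div_assoc, ← mul_pow, Complex.ofReal_neg, neg_one_mul, mul_neg]

theorem IsExpI.adjoint {θ : ℝ} {A : Module.End ℂ PhotonCore}
    {U : PhotonSpace →L[ℂ] PhotonSpace} (hA : IsCoreSymmetric A) (hU : IsExpI θ A U) :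
    IsExpI (-θ) A (ContinuousLinearMap.adjoint U) := by
  intro f
  have hseries := (hU.summable_neg f).hasSum
  convert hseries
  refine eq_of_inner_toFock fun g => ?_
  have hright := hseries.mapL (innerSL ℂ (toFock g))
  have hleft := ((hU g).mapL (innerSL ℂ (toFock f))).map (starRingEnd ℂ) Complex.continuous_conj
  simp only [innerSL_apply_apply, Function.comp_def, inner_conj_symm] at hright hleft
  rw [ContinuousLinearMap.adjoint_inner_right]
  refine hleft.unique (hright.congr_fun fun k => ?_)
  rw [inner_smul_left, inner_smul_right, hA.pow k g f]
  simp

theorem expI_neg {θ : ℝ} {A : Module.End ℂ PhotonCore} (hA : IsCoreSymmetric A) :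
    expI (-θ) A = ContinuousLinearMap.adjoint (expI θ A) := by
  by_cases hex : ∃ U, IsExpI θ A U
  · obtain ⟨U, hU⟩ := hex
    rw [hU.expI_eq, (hU.adjoint hA).expI_eq]
  · have hex_neg : ¬ ∃ U, IsExpI (-θ) A U := by
      rintro ⟨U, hU⟩
      exact hex ⟨_, by simpa only [neg_neg] using hU.adjoint hA⟩
    rw [expI_eq_zero hex, expI_eq_zero hex_neg, map_zero]

theorem IsExpI.conj {θ : ℝ} {A A' : Module.End ℂ PhotonCore} {U : PhotonSpace →L[ℂ] PhotonSpace}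
    (G : PhotonSpace ≃ₗᵢ[ℂ] PhotonSpace) (G₀ : PhotonCore ≃ₗ[ℂ] PhotonCore)
    (hG : ∀ f, G (toFock f) = toFock (G₀ f)) (hA : Function.Semiconj G₀ A A')
    (hU : IsExpI θ A U) :
    IsExpI θ A' ((G : PhotonSpace →L[ℂ] PhotonSpace) ∘L U ∘L
      (G.symm : PhotonSpace →L[ℂ] PhotonSpace)) := by
  intro g
  obtain ⟨f, rfl⟩ := G₀.surjective g
  have hsymm : G.symm (toFock (G₀ f)) = toFock f := by rw [← hG, G.symm_apply_apply]
  change HasSum _ (G (U (G.symm (toFock (G₀ f)))))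
  rw [hsymm]
  refine ((hU f).mapL (G : PhotonSpace →L[ℂ] PhotonSpace)).congr_fun fun k => ?_
  change _ = G _
  rw [map_smul, hG, Module.End.pow_apply, Module.End.pow_apply, hA.iterate_right k f]

theorem expI_conj (θ : ℝ) {A A' : Module.End ℂ PhotonCore} (G : PhotonSpace ≃ₗᵢ[ℂ] PhotonSpace)
    (G₀ : PhotonCore ≃ₗ[ℂ] PhotonCore) (hG : ∀ f, G (toFock f) = toFock (G₀ f))
    (hA : Function.Semiconj G₀ A A') (ψ : PhotonSpace) :
    G (expI θ A ψ) = expI θ A' (G ψ) := by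
  by_cases hex : ∃ U, IsExpI θ A U
  · obtain ⟨U, hU⟩ := hex
    rw [hU.expI_eq, (hU.conj G G₀ hG hA).expI_eq]
    simp
  · have hex' : ¬ ∃ U, IsExpI θ A' U := by
      rintro ⟨U, hU⟩
      refine hex ⟨_, hU.conj G.symm G₀.symm (fun f => ?_) fun f => ?_⟩
      · rw [G.symm_apply_eq, hG, G₀.apply_symm_apply]
      · rw [G₀.symm_apply_eq, hA, G₀.apply_symm_apply]
    simp [expI_eq_zero hex, expI_eq_zero hex']

end Exponentials

section ModeSubstitution

variable {K P R : Type*} [CommRing K] [Fintype R]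

/-- The algebra homomorphism `X_{p,r} ↦ ∑ a(p)_{r,r'} X_{σ p,r'}` of polynomials in the modes
`(p, r)`. -/
def modeSubst (σ : P ≃ P) (a : P → Matrix R R K) :
    MvPolynomial (P × R) K →ₐ[K] MvPolynomial (P × R) K :=
  MvPolynomial.aeval fun m => ∑ r', a m.1 m.2 r' • MvPolynomial.X (σ m.1, r')

variable (σ : P ≃ P) (a : P → Matrix R R K)

theorem modeSubst_X (m : P × R) :
    modeSubst σ a (MvPolynomial.X m) = ∑ r', a m.1 m.2 r' • MvPolynomial.X (σ m.1, r') :=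
  MvPolynomial.aeval_X _ _

theorem pderiv_modeSubst_X (p : P) (r' : R) (m : P × R) :
    MvPolynomial.pderiv (σ p, r') (modeSubst σ a (MvPolynomial.X m)) =
      ∑ r, a p r r' • modeSubst σ a (MvPolynomial.pderiv (p, r) (MvPolynomial.X m)) := by
  classical
  obtain ⟨q, s⟩ := m
  rw [modeSubst_X]
  simp only [map_sum, Derivation.map_smul, MvPolynomial.pderiv_X, Pi.single_apply, Prod.mk.injEq,
    σ.injective.eq_iff]
  by_cases h : q = p
  · subst h
    simp [apply_ite (modeSubst σ a)]
  · simp [h]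

theorem pderiv_modeSubst (p : P) (r' : R) (f : MvPolynomial (P × R) K) :
    MvPolynomial.pderiv (σ p, r') (modeSubst σ a f) =
      ∑ r, a p r r' • modeSubst σ a (MvPolynomial.pderiv (p, r) f) := by
  induction f using MvPolynomial.induction_on with
  | C c => simp [MvPolynomial.algebraMap_eq]
  | add f g hf hg => simp only [map_add, hf, hg, smul_add, Finset.sum_add_distrib]
  | mul_X f m hf =>
    simp only [map_mul, Derivation.leibniz, map_add, smul_add, Finset.sum_add_distrib, hf,
      pderiv_modeSubst_X, smul_eq_mul, Finset.mul_sum, mul_smul_comm]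

variable [DecidableEq R]

theorem modeSubst_comp (σ' : P ≃ P) (a' : P → Matrix R R K)
    (hσ : ∀ p, σ' (σ p) = p) (ha : ∀ p, a p * a' (σ p) = 1) :
    (modeSubst σ' a').comp (modeSubst σ a) = AlgHom.id K _ := by
  refine MvPolynomial.algHom_ext fun ⟨p, r⟩ => ?_
  have hentry : ∀ r'', ∑ r', a p r r' * a' (σ p) r' r'' = if r = r'' then 1 else 0 := fun r'' => by
    rw [← Matrix.mul_apply, ha, Matrix.one_apply]
  simp only [AlgHom.comp_apply, modeSubst_X, map_sum, map_smul, hσ, Finset.smul_sum, smul_smul,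
    AlgHom.id_apply]
  rw [Finset.sum_comm]
  simp only [← Finset.sum_smul, hentry, ite_smul, one_smul, zero_smul, Finset.sum_ite_eq,
    Finset.mem_univ, if_true]

/-- The substitution `modeSubst` by unitary matrices, as an automorphism: the second quantization
of a unitary transformation of the modes, on polynomials in the creation operators. -/
def modeEquiv [StarRing K] (a : P → Matrix.unitaryGroup R K) :
    MvPolynomial (P × R) K ≃ₐ[K] MvPolynomial (P × R) K :=
  AlgEquiv.ofAlgHom (modeSubst σ fun p => a p)
    (modeSubst σ.symm fun q => (star (a (σ.symm q)) : Matrix.unitaryGroup R K))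
    (modeSubst_comp _ _ _ _ σ.apply_symm_apply fun q =>
      Matrix.UnitaryGroup.star_mul_self _)
    (modeSubst_comp _ _ _ _ σ.symm_apply_apply fun p => by
      rw [σ.symm_apply_apply]
      exact Matrix.mem_unitaryGroup_iff.1 (a p).2)

end ModeSubstitution

section Bargmann

/-- The square root of the product of the factorials of the occupation numbers: the norm of the
corresponding monomial in the creation operators applied to the vacuum, up to powers of
`√(L 𝒜_Λ)`. -/
def sqrtFactorial (n : Occ) : ℝ := √(n.prod fun _ k => (k.factorial : ℝ))

theorem sqrtFactorial_pos (n : Occ) : 0 < sqrtFactorial n :=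
  Real.sqrt_pos.2 (Finset.prod_pos fun _ _ => Nat.cast_pos.2 (Nat.factorial_pos _))

theorem ofReal_sqrtFactorial_ne_zero (n : Occ) : (sqrtFactorial n : ℂ) ≠ 0 :=
  Complex.ofReal_ne_zero.2 (sqrtFactorial_pos n).ne'

theorem sqrtFactorial_add_single (n : Occ) (m : Mode) :
    sqrtFactorial (n + Finsupp.single m 1) = √((n m : ℝ) + 1) * sqrtFactorial n := by
  have hzero : ∀ _ : Mode, ((Nat.factorial 0 : ℕ) : ℝ) = 1 := fun _ => by simp
  have herase : (n + Finsupp.single m 1).erase m = n.erase m := by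
    rw [Finsupp.erase_add, Finsupp.erase_single, add_zero]
  rw [sqrtFactorial, sqrtFactorial, ← Real.sqrt_mul (by positivity),
    ← Finsupp.mul_prod_erase' _ m _ hzero, ← Finsupp.mul_prod_erase' n m _ hzero, herase]
  congr 1
  simp only [Finsupp.add_apply, Finsupp.single_eq_same, Nat.factorial_succ]
  push_cast
  ring

/-- The Bargmann representation: a finite combination of occupation number states is identified
with the polynomial in the (normalized) creation operators that yields it from the vacuum. -/
def toPoly : PhotonCore ≃ₗ[ℂ] MvPolynomial Mode ℂ :=
  ((MvPolynomial.basisMonomials Mode ℂ).isUnitSMul (w := fun n => (sqrtFactorial n : ℂ)⁻¹)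
    fun n => (inv_ne_zero (ofReal_sqrtFactorial_ne_zero n)).isUnit).repr.symm

theorem toPoly_single (n : Occ) (c : ℂ) :
    toPoly (Finsupp.single n c) = MvPolynomial.monomial n (c * (sqrtFactorial n : ℂ)⁻¹) := by
  rw [toPoly, Module.Basis.repr_symm_single, Module.Basis.isUnitSMul_apply,
    MvPolynomial.coe_basisMonomials, MvPolynomial.smul_monomial, MvPolynomial.smul_monomial,
    smul_eq_mul, smul_eq_mul, mul_one]

variable (L : ℕ)

theorem mul_area_nonneg : 0 ≤ (L : ℝ) * area L := by
  unfold area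
  positivity

theorem mul_area_pos [NeZero L] : 0 < (L : ℝ) * area L := by
  have : 0 < (L : ℝ) := Nat.cast_pos.2 (NeZero.pos L)
  unfold area
  positivity

theorem ofReal_sqrt_natCast_add_one_ne_zero (k : ℕ) : ((√((k : ℝ) + 1) : ℝ) : ℂ) ≠ 0 :=
  Complex.ofReal_ne_zero.2 (Real.sqrt_pos.2 (by positivity)).ne'

theorem toPoly_photonCre (m : Mode) (f : PhotonCore) :
    toPoly (photonCre L m f) =
      ((√(L * area L) : ℝ) : ℂ) • (toPoly f * MvPolynomial.X m) := by
  induction f using Finsupp.induction_linear with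
  | zero => simp
  | add f g hf hg => simp only [map_add, hf, hg, add_mul, smul_add]
  | single n c =>
    have hsqrt := ofReal_sqrt_natCast_add_one_ne_zero (n m)
    have hfact := ofReal_sqrtFactorial_ne_zero n
    rw [photonCre_single, toPoly_single, toPoly_single, MvPolynomial.X,
      MvPolynomial.monomial_mul, MvPolynomial.smul_monomial, sqrtFactorial_add_single,
      Real.sqrt_mul (mul_area_nonneg L), smul_eq_mul]
    congr 1
    push_cast
    field_simp

theorem toPoly_photonAnn (m : Mode) (f : PhotonCore) :
    toPoly (photonAnn L m f) =
      ((√(L * area L) : ℝ) : ℂ) • MvPolynomial.pderiv m (toPoly f) := by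
  induction f using Finsupp.induction_linear with
  | zero => simp
  | add f g hf hg => simp only [map_add, hf, hg, smul_add]
  | single n c =>
    rw [photonAnn_single, toPoly_single, toPoly_single, MvPolynomial.pderiv_monomial]
    by_cases hn : n m = 0
    · simp [hn]
    · obtain ⟨k, rfl⟩ := exists_add_single_of_ne_zero hn
      have hfact := ofReal_sqrtFactorial_ne_zero k
      have hsqrt := ofReal_sqrt_natCast_add_one_ne_zero (k m)
      have hsq : ((√((k m : ℝ) + 1) : ℝ) : ℂ) * ((√((k m : ℝ) + 1) : ℝ) : ℂ) = (k m : ℂ) + 1 := by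
        rw [← Complex.ofReal_mul, Real.mul_self_sqrt (by positivity), Complex.ofReal_add,
          Complex.ofReal_natCast, Complex.ofReal_one]
      rw [MvPolynomial.smul_monomial, add_tsub_cancel_right, sqrtFactorial_add_single,
        Real.sqrt_mul (mul_area_nonneg L), smul_eq_mul]
      congr 1
      simp only [Finsupp.add_apply, Finsupp.single_eq_same]
      push_cast
      rw [← hsq]
      field_simp

end Bargmann

section ModeTransformations

variable (L : ℕ) (σ : Momentum ≃ Momentum) (a : Momentum → Matrix.unitaryGroup (Fin 2) ℂ)

/-- Second quantization of the unitary transformation of the modes given by the permutation `σ` of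
the momenta and the unitary matrices `a p` acting on the polarizations, on the finite combinations
of occupation number states. -/
def coreTransform : PhotonCore ≃ₗ[ℂ] PhotonCore :=
  (toPoly.trans (modeEquiv σ a).toLinearEquiv).trans toPoly.symm

theorem toPoly_coreTransform (f : PhotonCore) :
    toPoly (coreTransform σ a f) = modeSubst σ (fun p => a p) (toPoly f) :=
  toPoly.apply_symm_apply _

theorem coreTransform_vacuum (c : ℂ) :
    coreTransform σ a (Finsupp.single 0 c) = Finsupp.single 0 c := by
  apply toPoly.injective
  rw [toPoly_coreTransform, toPoly_single]
  exact (modeSubst σ fun p => (a p : Matrix (Fin 2) (Fin 2) ℂ)).commutes _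

theorem coreTransform_photonCre (p : Momentum) (r : Fin 2) (f : PhotonCore) :
    coreTransform σ a (photonCre L (p, r) f) =
      ∑ r', a p r r' • photonCre L (σ p, r') (coreTransform σ a f) := by
  apply toPoly.injective
  simp only [toPoly_coreTransform, map_sum, map_smul, toPoly_photonCre, map_mul, modeSubst_X,
    Finset.mul_sum, Finset.smul_sum, mul_smul_comm]
  exact Finset.sum_congr rfl fun r' _ => smul_comm _ _ _

theorem photonAnn_coreTransform (p : Momentum) (r' : Fin 2) (f : PhotonCore) :
    photonAnn L (σ p, r') (coreTransform σ a f) =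
      ∑ r, a p r r' • coreTransform σ a (photonAnn L (p, r) f) := by
  apply toPoly.injective
  simp only [map_sum, map_smul, toPoly_photonAnn, toPoly_coreTransform, pderiv_modeSubst,
    Finset.smul_sum]
  exact Finset.sum_congr rfl fun r' _ => smul_comm _ _ _

theorem coreTransform_photonAnn (p : Momentum) (r : Fin 2) (f : PhotonCore) :
    coreTransform σ a (photonAnn L (p, r) f) =
      ∑ r', star (a p r r') • photonAnn L (σ p, r') (coreTransform σ a f) := by
  have hrow : ∀ s, ∑ r', star (a p r r') * a p s r' = if s = r then 1 else 0 := fun s => by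
    rw [← Matrix.one_apply, ← Matrix.mem_unitaryGroup_iff.1 (a p).2, Matrix.mul_apply]
    exact Finset.sum_congr rfl fun r' _ => mul_comm _ _
  simp only [photonAnn_coreTransform, Finset.smul_sum, smul_smul]
  rw [Finset.sum_comm]
  simp only [← Finset.sum_smul, hrow, ite_smul, one_smul, zero_smul, Finset.sum_ite_eq',
    Finset.mem_univ, if_true]

theorem photonCre_apply_zero (m : Mode) (f : PhotonCore) : photonCre L m f 0 = 0 := by
  have h := inner_photonAnn L m (Finsupp.single 0 1) f
  rw [photonAnn_single, inner_toFock_single, inner_toFock_single, toFock_apply] at h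
  simpa [toFock_apply] using h.symm

theorem photonEnergy_zero : photonEnergy L 0 = 0 := Finsupp.sum_zero_index

theorem photonEnergy_add_single (n : Occ) (m : Mode) :
    photonEnergy L (n + Finsupp.single m 1) = photonEnergy L n + absMomentum L m.1 := by
  rw [photonEnergy, Finsupp.sum_add_index' (by simp) (by intros; push_cast; ring),
    Finsupp.sum_single_index (by simp), Nat.cast_one, one_mul, photonEnergy]

/-- The photon energy on the finite combinations of occupation number states. -/
def coreEnergy : Module.End ℂ PhotonCore :=
  Finsupp.linearCombination ℂ fun n => Finsupp.single n (photonEnergy L n : ℂ)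

theorem coreEnergy_single (n : Occ) (c : ℂ) :
    coreEnergy L (Finsupp.single n c) = (photonEnergy L n : ℂ) • Finsupp.single n c := by
  rw [coreEnergy, Finsupp.linearCombination_single, Finsupp.smul_single, Finsupp.smul_single,
    smul_eq_mul, smul_eq_mul, mul_comm]

theorem coreEnergy_photonCre (m : Mode) (f : PhotonCore) :
    coreEnergy L (photonCre L m f) =
      photonCre L m (coreEnergy L f) + (absMomentum L m.1 : ℂ) • photonCre L m f := by
  induction f using Finsupp.induction_linear with
  | zero => simp
  | add f g hf hg => simp only [map_add, hf, hg, smul_add]; abel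
  | single n c =>
    rw [coreEnergy_single, map_smul, photonCre_single, coreEnergy_single,
      photonEnergy_add_single, ← add_smul, Complex.ofReal_add]

theorem inner_toFock_coreEnergy {ψ ψ' : PhotonSpace}
    (h : ∀ n, ψ' n = (photonEnergy L n : ℂ) * ψ n) (f : PhotonCore) :
    inner ℂ (toFock (coreEnergy L f)) ψ = inner ℂ (toFock f) ψ' := by
  induction f using Finsupp.induction_linear with
  | zero => simp
  | add f g hf hg => simp only [map_add, inner_add_left, hf, hg]
  | single k c =>
    rw [coreEnergy_single, map_smul, inner_smul_left, inner_toFock_single, inner_toFock_single,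
      h, Complex.conj_ofReal, mul_left_comm]

theorem forall_eq_photonEnergy_mul_iff {ψ ψ' : PhotonSpace} :
    (∀ n, ψ' n = (photonEnergy L n : ℂ) * ψ n) ↔
      ∀ f, inner ℂ (toFock (coreEnergy L f)) ψ = inner ℂ (toFock f) ψ' := by
  refine ⟨inner_toFock_coreEnergy L, fun h n => ?_⟩
  have hn := h (Finsupp.single n 1)
  rw [coreEnergy_single, map_smul, inner_smul_left, Complex.conj_ofReal, inner_toFock_single,
    inner_toFock_single, map_one, one_mul, one_mul] at hn
  exact hn.symm

theorem photonCore_induction {L : ℕ} [NeZero L] {P : PhotonCore → Prop}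
    (vacuum : ∀ c, P (Finsupp.single 0 c)) (add : ∀ f g, P f → P g → P (f + g))
    (cre : ∀ m f, P f → P (photonCre L m f)) (f : PhotonCore) : P f := by
  have add_quantum : ∀ (m : Mode) (k : Occ), (∀ c, P (Finsupp.single k c)) →
      ∀ c, P (Finsupp.single (k + Finsupp.single m 1) c) := by
    intro m k hk c
    have hne : ((√(L * area L * ((k m : ℝ) + 1)) : ℝ) : ℂ) ≠ 0 :=
      Complex.ofReal_ne_zero.2
        (Real.sqrt_pos.2 (mul_pos (mul_area_pos L) (by positivity))).ne'
    have hcre := cre m _ (hk (c / ((√(L * area L * ((k m : ℝ) + 1)) : ℝ) : ℂ)))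
    rwa [photonCre_single, div_mul_cancel₀ _ hne] at hcre
  have add_quanta : ∀ n k : Occ, (∀ c, P (Finsupp.single k c)) →
      ∀ c, P (Finsupp.single (k + n) c) := by
    intro n
    induction n using Finsupp.induction_linear with
    | zero => intro k hk; simpa only [add_zero] using hk
    | add n n' hn hn' => intro k hk; rw [← add_assoc]; exact hn' _ (hn k hk)
    | single m j =>
      induction j with
      | zero => intro k hk; simpa only [Finsupp.single_zero, add_zero] using hk
      | succ j ih =>
        intro k hk
        rw [Finsupp.single_add, ← add_assoc]
        exact add_quantum m _ (ih k hk)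
  induction f using Finsupp.induction_linear with
  | zero => simpa only [Finsupp.single_zero] using vacuum 0
  | add f g hf hg => exact add f g hf hg
  | single n c => simpa only [zero_add] using add_quanta n 0 vacuum c

theorem coreTransform_apply_zero (f : PhotonCore) : coreTransform σ a f 0 = f 0 := by
  induction f using photonCore_induction (L := 1) with
  | vacuum c => rw [coreTransform_vacuum]
  | add f g hf hg => rw [map_add, Finsupp.add_apply, Finsupp.add_apply, hf, hg]
  | cre m f _ =>
    obtain ⟨p, r⟩ := m
    simp [coreTransform_photonCre, photonCre_apply_zero]

theorem inner_coreTransform (f g : PhotonCore) :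
    inner ℂ (toFock (coreTransform σ a f)) (toFock (coreTransform σ a g)) =
      inner ℂ (toFock f) (toFock g) := by
  induction f using photonCore_induction (L := 1) generalizing g with
  | vacuum c =>
    rw [coreTransform_vacuum, inner_toFock_single, inner_toFock_single, toFock_apply,
      toFock_apply, coreTransform_apply_zero]
  | add f f' hf hf' => simp only [map_add, inner_add_left, hf, hf']
  | cre m f hf =>
    obtain ⟨p, r⟩ := m
    rw [inner_photonCre, ← hf, coreTransform_photonCre, coreTransform_photonAnn]
    simp only [map_sum, map_smul, sum_inner, inner_sum, inner_smul_left, inner_smul_right,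
      inner_photonCre]
    rfl

theorem coreEnergy_coreTransform [NeZero L] (hσ : ∀ p, absMomentum L (σ p) = absMomentum L p)
    (f : PhotonCore) :
    coreEnergy L (coreTransform σ a f) = coreTransform σ a (coreEnergy L f) := by
  induction f using photonCore_induction (L := L) with
  | vacuum c =>
    rw [coreTransform_vacuum, coreEnergy_single, photonEnergy_zero, Complex.ofReal_zero,
      zero_smul, map_zero]
  | add f g hf hg => simp only [map_add, hf, hg]
  | cre m f hf =>
    obtain ⟨p, r⟩ := m
    rw [coreEnergy_photonCre, map_add, map_smul, coreTransform_photonCre, coreTransform_photonCre,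
      map_sum, Finset.smul_sum, ← Finset.sum_add_distrib]
    refine Finset.sum_congr rfl fun r' _ => ?_
    rw [map_smul, coreEnergy_photonCre, hf, hσ, smul_add, smul_comm (absMomentum L p : ℂ)]

theorem orthonormal_coreTransform :
    Orthonormal ℂ fun n : Occ => toFock (coreTransform σ a (Finsupp.single n 1)) := by
  rw [orthonormal_iff_ite]
  intro n k
  rw [inner_coreTransform, inner_toFock_single, toFock_apply, map_one, one_mul]
  by_cases h : n = k
  · subst h; simp
  · rw [if_neg h, Finsupp.single_eq_of_ne h]

theorem span_coreTransform_orthogonal :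
    (Submodule.span ℂ (Set.range fun n : Occ =>
      toFock (coreTransform σ a (Finsupp.single n 1))))ᗮ = ⊥ := by
  rw [Submodule.eq_bot_iff]
  intro ψ hψ
  have horth : ∀ f, inner ℂ (toFock (coreTransform σ a f)) ψ = 0 := by
    intro f
    induction f using Finsupp.induction_linear with
    | zero => simp
    | add f g hf hg => simp only [map_add, inner_add_left, hf, hg, add_zero]
    | single n c =>
      rw [← mul_one c, ← smul_eq_mul, ← Finsupp.smul_single, map_smul, map_smul, inner_smul_left,
        hψ _ (Submodule.subset_span ⟨n, rfl⟩), mul_zero]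
  refine eq_of_inner_toFock fun f => ?_
  rw [inner_zero_right, ← (coreTransform σ a).apply_symm_apply f, horth]

/-- Second quantization of a unitary transformation of the modes, on Fock space: the extension of
`coreTransform`. -/
def fockTransform : PhotonSpace ≃ₗᵢ[ℂ] PhotonSpace :=
  (HilbertBasis.mkOfOrthogonalEqBot (orthonormal_coreTransform σ a)
    (span_coreTransform_orthogonal σ a)).repr.symm

theorem fockTransform_toFock (f : PhotonCore) :
    fockTransform σ a (toFock f) = toFock (coreTransform σ a f) := by
  classical
  induction f using Finsupp.induction_linear with
  | zero => simp
  | add f g hf hg => simp only [map_add, hf, hg]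
  | single n c =>
    have hbasis : fockTransform σ a (toFock (Finsupp.single n 1)) =
        toFock (coreTransform σ a (Finsupp.single n 1)) := by
      rw [toFock_single, fockTransform]
      convert HilbertBasis.repr_symm_single _ n using 1
      rw [HilbertBasis.coe_mkOfOrthogonalEqBot]
    rw [← mul_one c, ← smul_eq_mul, ← Finsupp.smul_single, map_smul, map_smul, map_smul, map_smul,
      hbasis]

theorem inner_fockTransform (f : PhotonCore) (ψ : PhotonSpace) :
    inner ℂ (toFock (coreTransform σ a f)) (fockTransform σ a ψ) = inner ℂ (toFock f) ψ := by
  rw [← fockTransform_toFock, LinearIsometryEquiv.inner_map_map]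

theorem fockTransform_eq_photonEnergy_mul_iff [NeZero L]
    (hσ : ∀ p, absMomentum L (σ p) = absMomentum L p) {ψ ψ' : PhotonSpace} :
    (∀ n, fockTransform σ a ψ' n = (photonEnergy L n : ℂ) * fockTransform σ a ψ n) ↔
      ∀ n, ψ' n = (photonEnergy L n : ℂ) * ψ n := by
  rw [forall_eq_photonEnergy_mul_iff, forall_eq_photonEnergy_mul_iff,
    (coreTransform σ a).surjective.forall]
  simp only [coreEnergy_coreTransform L σ a hσ, inner_fockTransform]

end ModeTransformations

section FermionTransform

variable {F : Type} [Fintype F]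

/-- The sign exchanging the operators of the one-particle states `f` and `g` contributes to the
Jordan-Wigner sign: `-1` if `f` precedes `g` in the enumeration of the one-particle states. -/
def orderSign (f g : F) : ℤˣ := if Fintype.equivFin F f < Fintype.equivFin F g then -1 else 1

/-- The sign with which the annihilation operator of `f` acts on the occupation number state
`S`. -/
def jordanWignerSign (f : F) (S : Finset F) : ℤˣ := ∏ g ∈ S, orderSign g f

/-- The sign of the pair `f, g` under a permutation of the one-particle states: `-1` if `f`
precedes `g` and the permutation reverses their order. -/
def inversionSign (π : F ≃ F) (f g : F) : ℤˣ :=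
  if Fintype.equivFin F f < Fintype.equivFin F g ∧
      Fintype.equivFin F (π g) < Fintype.equivFin F (π f) then -1 else 1

/-- The sign of the occupation number state `S` under a permutation of the one-particle states:
`-1` to the number of inversions in `S`. -/
def confSign (π : F ≃ F) (S : Finset F) : ℤˣ := ∏ f ∈ S, ∏ g ∈ S, inversionSign π f g

theorem inversionSign_self (π : F ≃ F) (f : F) : inversionSign π f f = 1 :=
  if_neg fun h => lt_irrefl _ h.1

theorem inversionSign_mul_inversionSign (π : F ≃ F) {f g : F} (hne : g ≠ f) :
    inversionSign π f g * inversionSign π g f = orderSign (π g) (π f) * orderSign g f := by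
  have hlt : Fintype.equivFin F g ≠ Fintype.equivFin F f := by simpa using hne
  have hlt' : Fintype.equivFin F (π g) ≠ Fintype.equivFin F (π f) := by simpa using hne
  rcases hlt.lt_or_gt with h | h <;> rcases hlt'.lt_or_gt with h' | h' <;>
    simp [inversionSign, orderSign, h, h', h.not_gt, h'.not_gt]

variable [DecidableEq F]

theorem confSign_insert (π : F ≃ F) {f : F} {S : Finset F} (hf : f ∉ S) :
    confSign π (insert f S) =
      (∏ g ∈ S, inversionSign π f g * inversionSign π g f) * confSign π S := by
  simp only [confSign, Finset.prod_insert hf, Finset.prod_mul_distrib, inversionSign_self, one_mul,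
    mul_assoc]

theorem jordanWignerSign_map (π : F ≃ F) {f : F} {S : Finset F} (hf : f ∉ S) :
    jordanWignerSign (π f) (π.finsetCongr S) =
      confSign π S * confSign π (insert f S) * jordanWignerSign f S := by
  have hmap : jordanWignerSign (π f) (π.finsetCongr S) = ∏ g ∈ S, orderSign (π g) (π f) := by
    rw [jordanWignerSign, Equiv.finsetCongr_apply, Finset.prod_map]
    rfl
  have hpair : ∏ g ∈ S, inversionSign π f g * inversionSign π g f =
      (∏ g ∈ S, orderSign (π g) (π f)) * jordanWignerSign f S := by
    rw [jordanWignerSign, ← Finset.prod_mul_distrib]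
    exact Finset.prod_congr rfl fun g hg =>
      inversionSign_mul_inversionSign π (ne_of_mem_of_not_mem hg hf)
  rw [confSign_insert π hf, hpair, hmap]
  set J := jordanWignerSign f S
  set c := confSign π S
  calc ∏ g ∈ S, orderSign (π g) (π f)
      = (∏ g ∈ S, orderSign (π g) (π f)) * (J * J) * (c * c) := by
        rw [Int.units_mul_self, Int.units_mul_self, mul_one, mul_one]
    _ = c * ((∏ g ∈ S, orderSign (π g) (π f)) * J * c) * J := by ac_rfl

theorem fermiAnn_insert {f : F} {S : Finset F} (hf : f ∉ S) :
    fermiAnn f S (insert f S) = ((jordanWignerSign f S : ℤ) : ℂ) := by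
  rw [fermiAnn, if_pos ⟨Finset.mem_insert_self f S, (Finset.erase_insert hf).symm⟩,
    Finset.filter_insert, if_neg (lt_irrefl _), ← Finset.prod_const, Finset.prod_filter,
    jordanWignerSign]
  push_cast
  exact Finset.prod_congr rfl fun g _ => by rw [orderSign]; split_ifs <;> simp

theorem fermiAnn_map (π : F ≃ F) (f : F) (S S' : Finset F) :
    fermiAnn (π f) (π.finsetCongr S) (π.finsetCongr S') =
      (confSign π S * confSign π S') • fermiAnn f S S' := by
  by_cases h : f ∈ S' ∧ S = S'.erase f
  · obtain ⟨hf, rfl⟩ := h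
    obtain ⟨T, hT, rfl⟩ : ∃ T, f ∉ T ∧ insert f T = S' :=
      ⟨S'.erase f, Finset.notMem_erase f S', Finset.insert_erase hf⟩
    have hmap : π.finsetCongr (insert f T) = insert (π f) (π.finsetCongr T) := by
      simp [Finset.map_insert]
    rw [Finset.erase_insert hT, hmap, fermiAnn_insert hT, fermiAnn_insert (by simpa using hT),
      jordanWignerSign_map π hT, Units.smul_def, zsmul_eq_mul, Units.val_mul, Int.cast_mul]
  · have h' : ¬ (π f ∈ π.finsetCongr S' ∧ π.finsetCongr S = (π.finsetCongr S').erase (π f)) := by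
      rw [Equiv.finsetCongr_apply, Equiv.finsetCongr_apply, Finset.mem_map_equiv,
        Equiv.symm_apply_apply]
      rintro ⟨hf, heq⟩
      refine h ⟨hf, Finset.map_injective π.toEmbedding ?_⟩
      rw [heq, Finset.map_erase, Equiv.coe_toEmbedding]
    rw [fermiAnn, fermiAnn, if_neg h, if_neg h', smul_zero]

end FermionTransform

section SignedConjugation

variable {ι R : Type*} [Ring R]

/-- `X'` is the conjugate of `X` by the signed permutation matrix of `e` and `s`. -/
def SignedConj (e : ι ≃ ι) (s : ι → ℤˣ) (X X' : Matrix ι ι R) : Prop :=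
  ∀ S S', X' (e S) (e S') = (s S * s S') • X S S'

namespace SignedConj

variable {e : ι ≃ ι} {s : ι → ℤˣ} {X X' Y Y' : Matrix ι ι R}

theorem one [DecidableEq ι] : SignedConj e s (1 : Matrix ι ι R) 1 := by
  intro S S'
  by_cases h : S = S'
  · subst h
    rw [Int.units_mul_self, one_smul, Matrix.one_apply_eq, Matrix.one_apply_eq]
  · rw [Matrix.one_apply_ne h, Matrix.one_apply_ne (e.injective.ne h), smul_zero]

theorem mul [Fintype ι] (hX : SignedConj e s X X') (hY : SignedConj e s Y Y') :
    SignedConj e s (X * Y) (X' * Y') := by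
  intro S S'
  rw [Matrix.mul_apply, Matrix.mul_apply, ← e.sum_comp, Finset.smul_sum]
  refine Finset.sum_congr rfl fun T _ => ?_
  have hsign : s S * s T * (s T * s S') = s S * s S' := by
    rw [mul_assoc, ← mul_assoc (s T), Int.units_mul_self, one_mul]
  rw [hX, hY, smul_mul_smul_comm, hsign]

theorem sub (hX : SignedConj e s X X') (hY : SignedConj e s Y Y') :
    SignedConj e s (X - Y) (X' - Y') := by
  intro S S'
  rw [Matrix.sub_apply, Matrix.sub_apply, hX, hY, smul_sub]

theorem smul {M : Type*} [SMul M R] [SMulCommClass M ℤˣ R] (c : M) (hX : SignedConj e s X X') :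
    SignedConj e s (c • X) (c • X') := by
  intro S S'
  rw [Matrix.smul_apply, Matrix.smul_apply, hX, smul_comm]

theorem sum {κ : Type*} (t : Finset κ) {X X' : κ → Matrix ι ι R}
    (hX : ∀ k, SignedConj e s (X k) (X' k)) :
    SignedConj e s (∑ k ∈ t, X k) (∑ k ∈ t, X' k) := by
  intro S S'
  rw [Matrix.sum_apply, Matrix.sum_apply, Finset.smul_sum]
  exact Finset.sum_congr rfl fun k _ => hX k S S'

theorem conjTranspose [StarRing R] (hX : SignedConj e s X X') :
    SignedConj e s X.conjTranspose X'.conjTranspose := by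
  intro S S'
  rw [Matrix.conjTranspose_apply, Matrix.conjTranspose_apply, hX, Units.smul_def, Units.smul_def,
    star_zsmul, mul_comm]

end SignedConj

end SignedConjugation

section SpaceTransform

section SignedPermutation

variable {ι H : Type*} [Fintype ι] [NormedAddCommGroup H] [InnerProductSpace ℂ H]

/-- The unitary operator on `⊕_ι H` given by a signed permutation of the index set and a unitary
operator on `H`. -/
def signedPermTransform (e : ι ≃ ι) (s : ι → ℤˣ) (G : H ≃ₗᵢ[ℂ] H) :
    PiLp 2 (fun _ : ι => H) ≃ₗᵢ[ℂ] PiLp 2 (fun _ : ι => H) :=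
  (LinearIsometryEquiv.piLpCongrRight 2 fun S =>
    if s S = 1 then G else G.trans (LinearIsometryEquiv.neg ℂ)).trans
    (LinearIsometryEquiv.piLpCongrLeft 2 ℂ H e)

theorem signedPermTransform_apply (e : ι ≃ ι) (s : ι → ℤˣ) (G : H ≃ₗᵢ[ℂ] H)
    (ψ : PiLp 2 (fun _ : ι => H)) (S : ι) :
    signedPermTransform e s G ψ (e S) = s S • G (ψ S) := by
  have hcases : signedPermTransform e s G ψ (e S) =
      (if s S = 1 then G else G.trans (LinearIsometryEquiv.neg ℂ)) (ψ S) := by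
    simp [signedPermTransform, LinearIsometryEquiv.piLpCongrLeft_apply]
  rw [hcases]
  rcases Int.units_eq_one_or (s S) with h | h <;> simp [h]

end SignedPermutation

variable {L : ℕ} [NeZero L]

theorem Obs.act_apply (X : Obs L) (ψ : Space L) (S : FConf L) :
    X.act ψ S = ∑ S', X S S' (ψ S') := rfl

/-- `Obs.act` as a linear map. -/
def Obs.actLinear : Obs L →ₗ[ℂ] Space L →ₗ[ℂ] Space L where
  toFun := Obs.act
  map_add' X Y := by
    ext ψ S
    simp [Obs.act_apply, Finset.sum_add_distrib]
  map_smul' c X := by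
    ext ψ S
    simp [Obs.act_apply, Finset.smul_sum]

theorem Obs.act_add (X Y : Obs L) : (X + Y).act = X.act + Y.act := map_add Obs.actLinear X Y

theorem Obs.act_smul (c : ℂ) (X : Obs L) : (c • X).act = c • X.act := map_smul Obs.actLinear c X

theorem Obs.act_neg (X : Obs L) : (-X).act = -X.act := map_neg Obs.actLinear X

theorem Obs.act_sum {κ : Type*} (t : Finset κ) (X : κ → Obs L) :
    (∑ k ∈ t, X k).act = ∑ k ∈ t, (X k).act := map_sum Obs.actLinear X t

theorem signedPermTransform_tensorOp {e : FConf L ≃ FConf L} {s : FConf L → ℤˣ}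
    {G : PhotonSpace ≃ₗᵢ[ℂ] PhotonSpace} {X X' : Matrix (FConf L) (FConf L) ℂ}
    {V V' : PhotonSpace →L[ℂ] PhotonSpace} (hX : SignedConj e s X X')
    (hV : ∀ ψ, G (V ψ) = V' (G ψ)) (ψ : Space L) :
    signedPermTransform e s G ((tensorOp X V).act ψ) =
      (tensorOp X' V').act (signedPermTransform e s G ψ) := by
  ext1 T
  obtain ⟨S, rfl⟩ := e.surjective T
  rw [signedPermTransform_apply, Obs.act_apply, Obs.act_apply, map_sum, Finset.smul_sum,
    ← e.sum_comp fun T => tensorOp X' V' (e S) T (signedPermTransform e s G ψ T)]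
  refine Finset.sum_congr rfl fun S' _ => ?_
  have hsign : s S * s S' * s S' = s S := by rw [mul_assoc, Int.units_mul_self, mul_one]
  have hV' : V' (s S' • G (ψ S')) = s S' • V' (G (ψ S')) := by
    rw [Units.smul_def, Units.smul_def, map_zsmul]
  simp only [tensorOp, Matrix.map_apply, smul_apply, map_smul, signedPermTransform_apply, hX S S',
    hV, hV', smul_assoc]
  rw [smul_comm (X S S') (s S'), ← mul_smul, hsign]

end SpaceTransform

section ModelSymmetry

variable {L : ℕ}

/-- The permutation of the sites given by permutations of the cells of the two sublattices. -/
def siteEquiv (α γ : Cell L ≃ Cell L) : Site L ≃ Site L :=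
  (Equiv.refl (Fin 2)).prodShear ![α, γ]

theorem siteEquiv_one (α γ : Cell L ≃ Cell L) (x : Cell L) :
    siteEquiv α γ (1, x) = (1, γ x) := rfl

/-- The permutation of the one-particle states of the electrons given by a permutation of the
sites. -/
def orbitalEquiv (ς : Site L ≃ Site L) : Orbital L ≃ Orbital L := ς.prodCongr (Equiv.refl _)

theorem Model.semiconj_coreTransform_bondField (m : Model L) (σ : Momentum ≃ Momentum)
    (w : Momentum → Matrix.unitaryGroup (Fin 2) ℂ) {x x' : Cell L} {i i' : Fin 3}
    (hf : ∀ p r, m.fieldCoeff x' i' (σ p) r = ∑ r', w p r r' * m.fieldCoeff x i p r') :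
    Function.Semiconj (coreTransform σ fun p => star (w p)) (m.bondField x i)
      (m.bondField x' i') := by
  set T := coreTransform σ fun p => star (w p) with hT
  have hconj : m.bondField x' i' = T.conj (m.bondField x i) := by
    rw [Model.bondField, Model.bondField, AddEquivClass.map_finsum, ← finsum_comp_equiv σ]
    refine finsum_congr fun p => LinearMap.ext fun g => ?_
    obtain ⟨f, rfl⟩ := T.surjective g
    rw [LinearEquiv.conj_apply_apply, T.symm_apply_apply]
    simp only [LinearMap.add_apply, LinearMap.smul_apply, map_add, map_smul, hT,
      coreTransform_photonAnn, coreTransform_photonCre, hf, Fin.sum_univ_two,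
      Unitary.coe_star, Matrix.star_apply, star_star, star_add, star_mul']
    module
  intro f
  rw [hconj, LinearEquiv.conj_apply_apply, T.symm_apply_apply]

/-- A symmetry of the model: permutations of the cells of the two sublattices, of the directions of
the bonds and of the photon momenta, and rotations of the polarizations, compatible with the
geometry, the photon field and the Coulomb potential. -/
structure Model.Symmetry (m : Model L) where
  cellA : Cell L ≃ Cell L
  cellB : Cell L ≃ Cell L
  dir : Fin 3 ≃ Fin 3
  mom : Momentum ≃ Momentum
  pol : Momentum → Matrix.unitaryGroup (Fin 2) ℂ
  cellB_neighbour : ∀ x i, cellB (neighbourCell x i) = neighbourCell (cellA x) (dir i)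
  absMomentum_mom : ∀ p, absMomentum L (mom p) = absMomentum L p
  fieldCoeff_mom : ∀ x i p r, m.fieldCoeff (cellA x) (dir i) (mom p) r =
    ∑ r', pol p r r' * m.fieldCoeff x i p r'
  coulomb_site : ∀ s s', m.coulomb (sitePos (siteEquiv cellA cellB s) -
    sitePos (siteEquiv cellA cellB s')) = m.coulomb (sitePos s - sitePos s')

namespace Model.Symmetry

variable {m : Model L} (Y : m.Symmetry)

/-- The action of a symmetry on the photon Fock space. -/
def photonUnitary : PhotonSpace ≃ₗᵢ[ℂ] PhotonSpace :=
  fockTransform Y.mom fun p => star (Y.pol p)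

theorem photonUnitary_expI (θ : ℝ) (x : Cell L) (i : Fin 3) (ψ : PhotonSpace) :
    Y.photonUnitary (expI θ (m.bondField x i) ψ) =
      expI θ (m.bondField (Y.cellA x) (Y.dir i)) (Y.photonUnitary ψ) :=
  expI_conj θ _ _ (fockTransform_toFock Y.mom _)
    (m.semiconj_coreTransform_bondField Y.mom Y.pol fun p r => Y.fieldCoeff_mom x i p r) ψ

end Model.Symmetry

theorem photonHamiltonian_mem_graph_iff {ψ ψ' : Space L} :
    (ψ, ψ') ∈ (photonHamiltonian L).graph ↔
      ∀ S n, ψ' S n = (photonEnergy L n : ℂ) * ψ S n := by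
  rw [LinearPMap.mem_graph_iff]
  constructor
  · rintro ⟨χ, rfl, rfl⟩ S n
    rfl
  · intro h
    have hmem : ψ ∈ (photonHamiltonian L).domain := fun S => by
      simpa only [funext (h S)] using lp.memℓp (ψ' S)
    refine ⟨⟨ψ, hmem⟩, rfl, ?_⟩
    ext S n
    exact (h S n).symm

variable [NeZero L]

/-- `X'` is the conjugate of `X` by the second quantization of a permutation of the sites. -/
def SiteConj (ς : Site L ≃ Site L) (X X' : Matrix (FConf L) (FConf L) ℂ) : Prop :=
  SignedConj (orbitalEquiv ς).finsetCongr (confSign (orbitalEquiv ς)) X X'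

section SiteConj

variable (ς : Site L ≃ Site L)

theorem siteConj_ann (s : Site L) (τ : Fin 2) : SiteConj ς (ann s τ) (ann (ς s) τ) :=
  fermiAnn_map (orbitalEquiv ς) (s, τ)

theorem siteConj_cre (s : Site L) (τ : Fin 2) : SiteConj ς (cre s τ) (cre (ς s) τ) :=
  (siteConj_ann ς s τ).conjTranspose

theorem siteConj_hop (s s' : Site L) (τ : Fin 2) :
    SiteConj ς (cre s τ * ann s' τ) (cre (ς s) τ * ann (ς s') τ) :=
  (siteConj_cre ς s τ).mul (siteConj_ann ς s' τ)

theorem siteConj_density (s : Site L) : SiteConj ς (density s) (density (ς s)) :=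
  SignedConj.sum _ fun τ => siteConj_hop ς s s τ

theorem Model.siteConj_coulombEnergy (m : Model L)
    (hc : ∀ s s', m.coulomb (sitePos (ς s) - sitePos (ς s')) =
      m.coulomb (sitePos s - sitePos s')) :
    SiteConj ς m.coulombEnergy m.coulombEnergy := by
  have hreindex : m.coulombEnergy = ((m.e ^ 2 / 2 : ℝ) : ℂ) • ∑ s : Site L, ∑ s' : Site L,
      m.coulomb (sitePos s - sitePos s') • ((density (ς s) - 1) * (density (ς s') - 1)) := by
    rw [Model.coulombEnergy, ← ς.sum_comp]
    congr 1
    refine Finset.sum_congr rfl fun s _ => ?_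
    rw [← ς.sum_comp]
    exact Finset.sum_congr rfl fun s' _ => by rw [hc]
  have hcharge : ∀ s, SiteConj ς (density s - 1) (density (ς s) - 1) := fun s =>
    (siteConj_density ς s).sub .one
  have hsum : SiteConj ς m.coulombEnergy (((m.e ^ 2 / 2 : ℝ) : ℂ) • ∑ s : Site L, ∑ s' : Site L,
      m.coulomb (sitePos s - sitePos s') • ((density (ς s) - 1) * (density (ς s') - 1))) :=
    .smul _ (.sum _ fun s => .sum _ fun s' => .smul _ ((hcharge s).mul (hcharge s')))
  rwa [← hreindex] at hsum

end SiteConj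

namespace Model.Symmetry

variable {m : Model L} (Y : m.Symmetry)

/-- The permutation of the sites underlying a symmetry. -/
def site : Site L ≃ Site L := siteEquiv Y.cellA Y.cellB

/-- The action of a symmetry on the Hilbert space. -/
def unitary : Space L ≃ₗᵢ[ℂ] Space L :=
  signedPermTransform (orbitalEquiv Y.site).finsetCongr (confSign (orbitalEquiv Y.site))
    Y.photonUnitary

theorem unitary_apply (ψ : Space L) (S : FConf L) :
    Y.unitary ψ ((orbitalEquiv Y.site).finsetCongr S) =
      confSign (orbitalEquiv Y.site) S • Y.photonUnitary (ψ S) :=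
  signedPermTransform_apply _ _ _ ψ S

theorem unitary_tensorOp {X X' : Matrix (FConf L) (FConf L) ℂ}
    {V V' : PhotonSpace →L[ℂ] PhotonSpace} (hX : SiteConj Y.site X X')
    (hV : ∀ ψ, Y.photonUnitary (V ψ) = V' (Y.photonUnitary ψ)) (ψ : Space L) :
    Y.unitary ((tensorOp X V).act ψ) = (tensorOp X' V').act (Y.unitary ψ) :=
  signedPermTransform_tensorOp hX hV ψ

theorem unitary_bondOp (x : Cell L) (i : Fin 3) (ψ : Space L) :
    Y.unitary ((m.bondOp x i).act ψ) =
      (m.bondOp (Y.cellA x) (Y.dir i)).act (Y.unitary ψ) := by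
  have hhop : ∀ s s' τ, SiteConj Y.site (cre s τ * ann s' τ) _ := siteConj_hop Y.site
  simp only [Model.bondOp, Obs.act_sum, Obs.act_add, LinearMap.sum_apply, LinearMap.add_apply,
    map_sum, map_add, ← Y.cellB_neighbour]
  refine Finset.sum_congr rfl fun τ _ => congrArg₂ _ ?_ ?_
  · exact Y.unitary_tensorOp (hhop (0, x) (1, neighbourCell x i) τ) (Y.photonUnitary_expI _ x i) ψ
  · exact Y.unitary_tensorOp (hhop (1, neighbourCell x i) (0, x) τ) (Y.photonUnitary_expI _ x i) ψ

theorem unitary_boundedPart {φ φ' : Cell L → Fin 3 → ℝ}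
    (hφ : ∀ x i, φ' (Y.cellA x) (Y.dir i) = φ x i) (ψ : Space L) :
    Y.unitary ((m.boundedPart φ).act ψ) = (m.boundedPart φ').act (Y.unitary ψ) := by
  have hreindex : ∑ x : Cell L, ∑ i : Fin 3, ((m.t + φ' x i : ℝ) : ℂ) • m.bondOp x i =
      ∑ x : Cell L, ∑ i : Fin 3,
        ((m.t + φ x i : ℝ) : ℂ) • m.bondOp (Y.cellA x) (Y.dir i) := by
    rw [← Y.cellA.sum_comp]
    refine Finset.sum_congr rfl fun x _ => ?_
    rw [← Y.dir.sum_comp]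
    exact Finset.sum_congr rfl fun i _ => by rw [hφ]
  simp only [Model.boundedPart, hreindex, Obs.act_add, Obs.act_neg, Obs.act_sum, Obs.act_smul,
    LinearMap.add_apply, LinearMap.neg_apply, LinearMap.sum_apply, LinearMap.smul_apply,
    map_add, map_neg, map_sum, map_smul, Y.unitary_bondOp]
  congr 1
  exact Y.unitary_tensorOp (m.siteConj_coulombEnergy _ Y.coulomb_site) (fun _ => rfl) ψ

theorem unitary_mem_graph_iff {ψ ψ' : Space L} :
    (Y.unitary ψ, Y.unitary ψ') ∈ (photonHamiltonian L).graph ↔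
      (ψ, ψ') ∈ (photonHamiltonian L).graph := by
  rw [photonHamiltonian_mem_graph_iff, photonHamiltonian_mem_graph_iff,
    (orbitalEquiv Y.site).finsetCongr.surjective.forall]
  refine forall_congr' fun S => ?_
  refine Iff.trans (forall_congr' fun n => ?_)
    (fockTransform_eq_photonEnergy_mul_iff L Y.mom (fun p => star (Y.pol p)) Y.absMomentum_mom)
  rw [unitary_apply, unitary_apply]
  rcases Int.units_eq_one_or (confSign (orbitalEquiv Y.site) S) with h | h
  · rw [h, one_smul, one_smul]
    rfl
  · rw [h, Units.neg_smul, Units.neg_smul, one_smul, one_smul, lp.coeFn_neg, lp.coeFn_neg,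
      Pi.neg_apply, Pi.neg_apply, mul_neg, neg_inj]
    rfl

theorem intertwines_hamiltonian {φ φ' : Cell L → Fin 3 → ℝ}
    (hφ : ∀ x i, φ' (Y.cellA x) (Y.dir i) = φ x i) :
    Intertwines Y.unitary (m.hamiltonian φ) (m.hamiltonian φ') where
  map_mem_domain_iff ψ := by
    change Y.unitary ψ ∈ (photonHamiltonian L).domain ↔ ψ ∈ (photonHamiltonian L).domain
    rw [LinearPMap.mem_domain_iff, LinearPMap.mem_domain_iff, Y.unitary.surjective.exists]
    exact exists_congr fun ψ' => Y.unitary_mem_graph_iff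
  apply_map ψ hψ hψ' := by
    have hphoton : photonHamiltonian L ⟨Y.unitary ψ, hψ'⟩ =
        Y.unitary (photonHamiltonian L ⟨ψ, hψ⟩) :=
      LinearPMap.mem_graph_snd_inj _
        (LinearPMap.mem_graph (photonHamiltonian L) ⟨Y.unitary ψ, hψ'⟩)
        (Y.unitary_mem_graph_iff.2 (LinearPMap.mem_graph (photonHamiltonian L) ⟨ψ, hψ⟩)) rfl
    change photonHamiltonian L ⟨Y.unitary ψ, hψ'⟩ + (m.boundedPart φ').act (Y.unitary ψ) =
      Y.unitary (photonHamiltonian L ⟨ψ, hψ⟩ + (m.boundedPart φ).act ψ)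
    rw [map_add, hphoton, Y.unitary_boundedPart hφ]

theorem average_bondOp (β : ℝ) {φ φ' : Cell L → Fin 3 → ℝ}
    (hφ : ∀ x i, φ' (Y.cellA x) (Y.dir i) = φ x i) (x : Cell L) (i : Fin 3) :
    m.average β φ' (m.bondOp (Y.cellA x) (Y.dir i)) = m.average β φ (m.bondOp x i) :=
  (Y.intertwines_hamiltonian hφ).gibbsAverage_eq (Y.unitary_bondOp x i) β

end Model.Symmetry

end ModelSymmetry

section SelfAdjointness

variable {L : ℕ}

/-- The plane wave of the photons with momentum label `p` at the planar position `y`. -/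
def planeWave (L : ℕ) (p : Momentum) (y : Fin 2 → ℝ) : ℂ :=
  Complex.exp (-(Complex.I * ((planar L p ⬝ᵥ y : ℝ) : ℂ)))

theorem star_planeWave (p : Momentum) (y : Fin 2 → ℝ) :
    star (planeWave L p y) = planeWave L p (-y) := by
  rw [planeWave, planeWave, Complex.star_def, ← Complex.exp_conj, map_neg, map_mul, Complex.conj_I,
    Complex.conj_ofReal, dotProduct_neg, Complex.ofReal_neg, neg_mul, mul_neg]

theorem Model.star_coulomb (m : Model L) (y : Fin 2 → ℝ) : star (m.coulomb y) = m.coulomb (-y) := by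
  rw [Model.coulomb, Model.coulomb, star_mul', Complex.star_def, Complex.conj_ofReal]
  congr 1
  change starAddEquiv (∑ᶠ p : Momentum, _) = _
  rw [AddEquiv.map_finsum]
  refine finsum_congr fun p => ?_
  rw [starAddEquiv_apply, star_mul', Complex.star_def, Complex.conj_ofReal]
  exact congrArg _ (star_planeWave p y)

theorem photonHamiltonian_apply (ψ : (photonHamiltonian L).domain) (S : FConf L) (n : Occ) :
    photonHamiltonian L ψ S n = (photonEnergy L n : ℂ) * (ψ : Space L) S n := rfl

theorem photonEnergy_nonneg (n : Occ) : 0 ≤ photonEnergy L n :=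
  Finset.sum_nonneg fun _ _ => mul_nonneg (Nat.cast_nonneg _) (Real.sqrt_nonneg _)

variable [NeZero L]

theorem photonHamiltonian_isFormalAdjoint :
    (photonHamiltonian L).IsFormalAdjoint (photonHamiltonian L) := by
  intro ψ ψ'
  rw [PiLp.inner_apply, PiLp.inner_apply]
  refine Finset.sum_congr rfl fun S _ => ?_
  rw [lp.inner_eq_tsum, lp.inner_eq_tsum]
  refine tsum_congr fun n => ?_
  rw [photonHamiltonian_apply, photonHamiltonian_apply, ← smul_eq_mul, ← smul_eq_mul,
    inner_smul_left, inner_smul_right, Complex.conj_ofReal]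

theorem inner_tensorOp_act (X : Matrix (FConf L) (FConf L) ℂ) (V : PhotonSpace →L[ℂ] PhotonSpace)
    (ψ ψ' : Space L) :
    inner ℂ ((tensorOp X V).act ψ) ψ' =
      inner ℂ ψ ((tensorOp X.conjTranspose (ContinuousLinearMap.adjoint V)).act ψ') := by
  rw [PiLp.inner_apply, PiLp.inner_apply]
  simp only [Obs.act_apply, sum_inner, inner_sum, tensorOp, Matrix.map_apply, smul_apply,
    inner_smul_left, inner_smul_right, ContinuousLinearMap.adjoint_inner_right,
    Matrix.conjTranspose_apply]
  exact Finset.sum_comm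

theorem conjTranspose_hop (s s' : Site L) (τ : Fin 2) :
    (cre s τ * ann s' τ).conjTranspose = cre s' τ * ann s τ := by
  rw [Matrix.conjTranspose_mul, cre, cre, ann, ann, fermiCre, fermiCre,
    Matrix.conjTranspose_conjTranspose]

theorem conjTranspose_density (s : Site L) : (density s).conjTranspose = density s := by
  rw [density, Matrix.conjTranspose_sum]
  exact Finset.sum_congr rfl fun τ _ => conjTranspose_hop s s τ

namespace Model

variable (m : Model L)

theorem isSymmetric_bondOp (x : Cell L) (i : Fin 3) : (m.bondOp x i).act.IsSymmetric := by
  intro ψ ψ'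
  simp only [Model.bondOp, Obs.act_sum, Obs.act_add, LinearMap.sum_apply, LinearMap.add_apply,
    sum_inner, inner_sum, inner_add_left, inner_add_right]
  refine Finset.sum_congr rfl fun τ _ => ?_
  rw [inner_tensorOp_act, inner_tensorOp_act, conjTranspose_hop, conjTranspose_hop,
    expI_neg (m.isCoreSymmetric_bondField x i), ContinuousLinearMap.adjoint_adjoint, add_comm]

theorem conjTranspose_coulombEnergy : m.coulombEnergy.conjTranspose = m.coulombEnergy := by
  rw [Model.coulombEnergy, Matrix.conjTranspose_smul, Complex.star_def, Complex.conj_ofReal]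
  congr 1
  simp only [Matrix.conjTranspose_sum, Matrix.conjTranspose_smul, Matrix.conjTranspose_mul,
    Matrix.conjTranspose_sub, conjTranspose_density, Matrix.conjTranspose_one, Model.star_coulomb,
    neg_sub]
  exact Finset.sum_comm

theorem isSymmetric_boundedPart (φ : Cell L → Fin 3 → ℝ) :
    (m.boundedPart φ).act.IsSymmetric := by
  have hcoulomb :
      (tensorOp m.coulombEnergy (ContinuousLinearMap.id ℂ PhotonSpace)).act.IsSymmetric := by
    intro ψ ψ'
    rw [inner_tensorOp_act, m.conjTranspose_coulombEnergy, ContinuousLinearMap.adjoint_id]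
  have hhopping : (∑ x : Cell L, ∑ i : Fin 3,
      ((m.t + φ x i : ℝ) : ℂ) • m.bondOp x i).act.IsSymmetric := by
    intro ψ ψ'
    simp only [Obs.act_sum, Obs.act_smul, LinearMap.sum_apply, LinearMap.smul_apply, sum_inner,
      inner_sum, inner_smul_left, inner_smul_right, Complex.conj_ofReal,
      m.isSymmetric_bondOp _ _ ψ ψ']
  intro ψ ψ'
  rw [Model.boundedPart, Obs.act_add, Obs.act_neg, LinearMap.add_apply, LinearMap.add_apply,
    LinearMap.neg_apply, LinearMap.neg_apply, inner_add_left, inner_add_right, inner_neg_left,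
    inner_neg_right, hcoulomb, hhopping]

theorem hamiltonian_isFormalAdjoint (φ : Cell L → Fin 3 → ℝ) :
    (m.hamiltonian φ).IsFormalAdjoint (m.hamiltonian φ) := by
  intro ψ ψ'
  change inner ℂ (photonHamiltonian L ψ + (m.boundedPart φ).act (ψ : Space L)) (ψ' : Space L) =
    inner ℂ (ψ : Space L) (photonHamiltonian L ψ' + (m.boundedPart φ).act (ψ' : Space L))
  rw [inner_add_left, inner_add_right]
  exact congrArg₂ _ (photonHamiltonian_isFormalAdjoint ψ ψ') (m.isSymmetric_boundedPart φ _ _)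

end Model

end SelfAdjointness

section Peierls

variable {L : ℕ}

theorem exp_neg_mul_one_add_sub_le (a b : ℝ) : Real.exp (-a) * (1 + a - b) ≤ Real.exp (-b) :=
  calc Real.exp (-a) * (1 + a - b) ≤ Real.exp (-a) * Real.exp (a - b) :=
        mul_le_mul_of_nonneg_left (by linarith [Real.add_one_le_exp (a - b)]) (Real.exp_nonneg _)
    _ = Real.exp (-b) := by rw [← Real.exp_add]; congr 1; ring

theorem hasSum_sq_norm (ψ : PhotonSpace) : HasSum (fun n => ‖ψ n‖ ^ 2) (‖ψ‖ ^ 2) := by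
  simpa using lp.hasSum_norm (p := 2) (by norm_num) ψ

theorem hasSum_photonEnergy_mul_sq_norm (ψ : (photonHamiltonian L).domain) (S : FConf L) :
    HasSum (fun n => photonEnergy L n * ‖(ψ : Space L) S n‖ ^ 2)
      (inner ℂ ((ψ : Space L) S) (photonHamiltonian L ψ S)).re := by
  convert Complex.hasSum_re (lp.hasSum_inner (𝕜 := ℂ) ((ψ : Space L) S) (photonHamiltonian L ψ S))
    using 2 with n
  rw [photonHamiltonian_apply, ← smul_eq_mul (photonEnergy L n : ℂ), inner_smul_right,
    Complex.re_ofReal_mul, inner_self_eq_norm_sq_to_K]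
  norm_cast

theorem summable_sq_norm_mul_exp {β : ℝ} (hβ : 0 ≤ β) (ψ : PhotonSpace) :
    Summable fun n => ‖ψ n‖ ^ 2 * Real.exp (-(β * photonEnergy L n)) := by
  refine Summable.of_nonneg_of_le (fun n => by positivity) (fun n => ?_) (hasSum_sq_norm ψ).summable
  refine mul_le_of_le_one_right (sq_nonneg _) (Real.exp_le_one_iff.2 ?_)
  exact neg_nonpos.2 (mul_nonneg hβ (photonEnergy_nonneg n))

variable [NeZero L]

/-- An upper bound for the operator norm of a bounded operator: the sum of the norms of its
matrix entries. -/
def Obs.entrySum (X : Obs L) : ℝ := ∑ S, ∑ S', ‖X S S'‖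

theorem Obs.norm_inner_act_le (X : Obs L) (ψ : Space L) (hψ : ‖ψ‖ = 1) :
    ‖inner ℂ ψ (X.act ψ)‖ ≤ X.entrySum := by
  have hentry : ∀ S, ‖ψ S‖ ≤ 1 := fun S => hψ ▸ PiLp.norm_apply_le ψ S
  rw [PiLp.inner_apply]
  refine norm_sum_le_of_le _ fun S _ => ?_
  rw [Obs.act_apply, inner_sum]
  refine norm_sum_le_of_le _ fun S' _ => ?_
  calc ‖inner ℂ (ψ S) (X S S' (ψ S'))‖ ≤ ‖ψ S‖ * ‖X S S' (ψ S')‖ := norm_inner_le_norm _ _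
    _ ≤ 1 * (‖X S S'‖ * ‖ψ S'‖) :=
        mul_le_mul (hentry S) ((X S S').le_opNorm _) (norm_nonneg _) zero_le_one
    _ ≤ 1 * (‖X S S'‖ * 1) := by gcongr; exact hentry S'
    _ = ‖X S S'‖ := by ring

/-- The expectation `⟨ψ, e^{-βH} ψ⟩` for `H` the energy of the free photon field. -/
def photonGibbsExpectation (β : ℝ) (ψ : Space L) : ℝ :=
  ∑ S, ∑' n, ‖ψ S n‖ ^ 2 * Real.exp (-(β * photonEnergy L n))

/-- Jensen's inequality for the convex function `e^{-βE}` of the photon energy, proved with the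
tangent line at `a`. -/
theorem exp_neg_le_photonGibbsExpectation {β a : ℝ} (hβ : 0 ≤ β) (ψ : (photonHamiltonian L).domain)
    (hψ : ‖(ψ : Space L)‖ = 1)
    (ha : (inner ℂ (ψ : Space L) (photonHamiltonian L ψ)).re ≤ a) :
    Real.exp (-(β * a)) ≤ photonGibbsExpectation β (ψ : Space L) := by
  set ψ₀ : Space L := (ψ : Space L) with hψ₀
  set energy : FConf L → ℝ := fun S => (inner ℂ (ψ₀ S) (photonHamiltonian L ψ S)).re
  have htangent : ∀ S, Real.exp (-(β * a)) * ((1 + β * a) * ‖ψ₀ S‖ ^ 2 - β * energy S) ≤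
      ∑' n, ‖ψ₀ S n‖ ^ 2 * Real.exp (-(β * photonEnergy L n)) := by
    intro S
    refine hasSum_le (fun n => ?_) ((((hasSum_sq_norm (ψ₀ S)).mul_left (1 + β * a)).sub
      ((hasSum_photonEnergy_mul_sq_norm ψ S).mul_left β)).mul_left (Real.exp (-(β * a))))
      (summable_sq_norm_mul_exp hβ (ψ₀ S)).hasSum
    linarith [mul_le_mul_of_nonneg_left
      (exp_neg_mul_one_add_sub_le (β * a) (β * photonEnergy L n)) (sq_nonneg ‖ψ₀ S n‖)]
  have hnorm : ∑ S, ‖ψ₀ S‖ ^ 2 = 1 := by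
    rw [← PiLp.norm_sq_eq_of_L2, hψ, one_pow]
  have henergy : ∑ S, energy S ≤ a := by
    rwa [PiLp.inner_apply, Complex.re_sum] at ha
  calc Real.exp (-(β * a))
      ≤ Real.exp (-(β * a)) * ((1 + β * a) * 1 - β * ∑ S, energy S) :=
        le_mul_of_one_le_right (Real.exp_nonneg _)
          (by linarith [mul_le_mul_of_nonneg_left henergy hβ])
    _ = ∑ S, Real.exp (-(β * a)) * ((1 + β * a) * ‖ψ₀ S‖ ^ 2 - β * energy S) := by
        rw [← hnorm, ← Finset.mul_sum, Finset.sum_sub_distrib, ← Finset.mul_sum, ← Finset.mul_sum]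
    _ ≤ photonGibbsExpectation β ψ₀ := Finset.sum_le_sum fun S _ => htangent S

theorem sum_sq_norm_apply_le_one {ι : Type*} [Fintype ι] {v : ι → Space L} (hv : Orthonormal ℂ v)
    (S : FConf L) (n : Occ) : ∑ k, ‖v k S n‖ ^ 2 ≤ 1 := by
  classical
  have hbessel := hv.sum_inner_products_le (s := Finset.univ)
    (PiLp.single 2 S (lp.single 2 n (1 : ℂ)) : Space L)
  rw [PiLp.norm_single, lp.norm_single (by norm_num), norm_one, one_pow] at hbessel
  refine le_trans (le_of_eq (Finset.sum_congr rfl fun k _ => ?_)) hbessel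
  rw [← norm_inner_symm, PiLp.inner_apply, Finset.sum_eq_single S]
  · rw [PiLp.single_eq_same, lp.inner_single_left]
    simp
  · intro T _ hT
    rw [PiLp.single_eq_of_ne _ hT, inner_zero_left]
  · simp

theorem sum_photonGibbsExpectation_le {β : ℝ} (hβ : 0 < β) {ι : Type*} [Fintype ι]
    {v : ι → Space L} (hv : Orthonormal ℂ v) :
    ∑ k, photonGibbsExpectation β (v k) ≤
      ∑ _S : FConf L, ∑' n, Real.exp (-(β * photonEnergy L n)) := by
  simp only [photonGibbsExpectation]
  rw [Finset.sum_comm]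
  refine Finset.sum_le_sum fun S _ => ?_
  rw [← Summable.tsum_finsetSum fun k _ => summable_sq_norm_mul_exp hβ.le (v k S)]
  refine Summable.tsum_le_tsum (fun n => ?_)
    (summable_sum fun k _ => summable_sq_norm_mul_exp hβ.le (v k S))
    (summable_exp_neg_photonEnergy L hβ)
  rw [← Finset.sum_mul]
  exact mul_le_of_le_one_left (Real.exp_nonneg _) (sum_sq_norm_apply_le_one hv S n)

namespace Model

variable (m : Model L)

theorem exp_neg_le_photonGibbsExpectation_of_mem_eigenspace {β : ℝ} (hβ : 0 ≤ β)
    {φ : Cell L → Fin 3 → ℝ} {ψ : Space L} (hψ : ‖ψ‖ = 1) {E : ℝ}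
    (hE : ψ ∈ eigenspace (m.hamiltonian φ) E) :
    Real.exp (-(β * (E + (m.boundedPart φ).entrySum))) ≤ photonGibbsExpectation β ψ := by
  obtain ⟨hdom, heigen⟩ := mem_eigenspace.1 hE
  refine exp_neg_le_photonGibbsExpectation hβ ⟨ψ, hdom⟩ hψ ?_
  have hphoton : photonHamiltonian L ⟨ψ, hdom⟩ = (E : ℂ) • ψ - (m.boundedPart φ).act ψ := by
    rw [← heigen]
    exact (add_sub_cancel_right _ _).symm
  have hbounded := neg_le_of_abs_le
    ((Complex.abs_re_le_norm _).trans ((m.boundedPart φ).norm_inner_act_le ψ hψ))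
  rw [hphoton, inner_sub_right, inner_smul_right, inner_self_eq_norm_sq_to_K, hψ]
  simp only [Complex.sub_re, RCLike.ofReal_one, one_pow, mul_one, Complex.ofReal_re]
  linarith

/-- Peierls' inequality: the eigenvalues are compared with the free photon energy, at the price of
the norm of the bounded part. -/
theorem sum_exp_eigenvalues_le {β : ℝ} (hβ : 0 < β) (φ : Cell L → Fin 3 → ℝ)
    {ι : Type*} [Fintype ι] {v : ι → Space L} {E : ι → ℝ} (hv : Orthonormal ℂ v)
    (hE : ∀ k, v k ∈ eigenspace (m.hamiltonian φ) (E k)) :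
    ∑ k, Real.exp (-(β * E k)) ≤ Real.exp (β * (m.boundedPart φ).entrySum) *
      ∑ _S : FConf L, ∑' n, Real.exp (-(β * photonEnergy L n)) := by
  set C := (m.boundedPart φ).entrySum
  calc ∑ k, Real.exp (-(β * E k))
      = Real.exp (β * C) * ∑ k, Real.exp (-(β * (E k + C))) := by
        rw [Finset.mul_sum]
        refine Finset.sum_congr rfl fun k _ => ?_
        rw [← Real.exp_add]
        congr 1
        ring
    _ ≤ Real.exp (β * C) * ∑ k, photonGibbsExpectation β (v k) := by
        gcongr with k
        exact m.exp_neg_le_photonGibbsExpectation_of_mem_eigenspace hβ.le (hv.1 k) (hE k)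
    _ ≤ _ := by
        gcongr
        exact sum_photonGibbsExpectation_le hβ hv

theorem average_sum_smul {β : ℝ} (hβ : 0 < β) (φ : Cell L → Fin 3 → ℝ)
    {κ : Type*} (s : Finset κ) (c : κ → ℂ) (X : κ → Obs L) :
    m.average β φ (∑ k ∈ s, c k • X k) = ∑ k ∈ s, c k * m.average β φ (X k) := by
  simp only [Model.average, Obs.act_sum, Obs.act_smul]
  exact gibbsAverage_sum_smul s c _ fun k _ =>
    summable_gibbsTrace (m.hamiltonian_isFormalAdjoint φ)
      (fun _ _ _ _ hv hE => m.sum_exp_eigenvalues_le hβ φ hv hE) (X k).norm_inner_act_le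

theorem conj_average_bondOp (β : ℝ) (φ : Cell L → Fin 3 → ℝ) (x : Cell L) (i : Fin 3) :
    (starRingEnd ℂ) (m.average β φ (m.bondOp x i)) = m.average β φ (m.bondOp x i) :=
  conj_gibbsAverage (m.isSymmetric_bondOp x i)

end Model

end Peierls

section Polarizations

theorem exists_unitary_eq_sum_smul {ι E : Type*} [Fintype ι] [DecidableEq ι]
    [NormedAddCommGroup E] [InnerProductSpace ℂ E] (b : OrthonormalBasis ι ℂ E) {v : ι → E}
    (hv : Orthonormal ℂ v) : ∃ w : Matrix.unitaryGroup ι ℂ, ∀ r, v r = ∑ r', w r r' • b r' := by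
  refine ⟨⟨Matrix.of fun r r' => inner ℂ (b r') (v r), Matrix.mem_unitaryGroup_iff.2 ?_⟩,
    fun r => (b.sum_repr' (v r)).symm⟩
  ext r s
  rw [Matrix.mul_apply, Matrix.one_apply]
  simp only [Matrix.star_apply, Matrix.of_apply, Complex.star_def, inner_conj_symm]
  simp only [mul_comm (inner ℂ (b _) (v r)), b.sum_inner_mul_inner, orthonormal_iff_ite.1 hv,
    eq_comm]

theorem exists_polarization_change {n : ℕ} [NeZero n] {k : Fin (n + 1) → ℂ} (hk : k ≠ 0)
    {e e' : Fin n → Fin (n + 1) → ℂ}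
    (he : ∀ r r', star (e r) ⬝ᵥ e r' = if r = r' then 1 else 0)
    (he' : ∀ r r', star (e' r) ⬝ᵥ e' r' = if r = r' then 1 else 0)
    (hek : ∀ r, e r ⬝ᵥ star k = 0) (hek' : ∀ r, e' r ⬝ᵥ star k = 0) :
    ∃ w : Matrix.unitaryGroup (Fin n) ℂ, ∀ r, e' r = ∑ r', w r r' • e r' := by
  set W : Submodule ℂ (EuclideanSpace ℂ (Fin (n + 1))) := (ℂ ∙ WithLp.toLp 2 k)ᗮ
  have hW : Module.finrank ℂ W = n :=
    haveI : Fact (Module.finrank ℂ (EuclideanSpace ℂ (Fin (n + 1))) = n + 1) := ⟨by simp⟩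
    Submodule.finrank_orthogonal_span_singleton ((WithLp.toLp_eq_zero 2).not.2 hk)
  have horthonormal : ∀ {f : Fin n → Fin (n + 1) → ℂ}
      (_ : ∀ r r', star (f r) ⬝ᵥ f r' = if r = r' then 1 else 0) (hfk : ∀ r, f r ⬝ᵥ star k = 0),
      Orthonormal ℂ fun r =>
        (⟨WithLp.toLp 2 (f r), Submodule.mem_orthogonal_singleton_iff_inner_right.2 (hfk r)⟩ : W) :=
    fun hf _ => orthonormal_iff_ite.2 fun r r' => (dotProduct_comm _ _).trans (hf r r')
  have hcard : Fintype.card (Fin n) = Module.finrank ℂ W := by rw [hW, Fintype.card_fin]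
  have hbasis := coe_basisOfOrthonormalOfCardEqFinrank (horthonormal he hek) hcard
  obtain ⟨w, hw⟩ := exists_unitary_eq_sum_smul
    ((basisOfOrthonormalOfCardEqFinrank (horthonormal he hek) hcard).toOrthonormalBasis
      (by rw [hbasis]; exact horthonormal he hek)) (horthonormal he' hek')
  refine ⟨w, fun r => ?_⟩
  have hr := congrArg (fun x : W => (x : EuclideanSpace ℂ (Fin (n + 1))).ofLp) (hw r)
  simpa [hbasis] using hr

end Polarizations

section PlaneWaves

variable {L : ℕ}

theorem planeWave_add (p : Momentum) (y z : Fin 2 → ℝ) :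
    planeWave L p (y + z) = planeWave L p y * planeWave L p z := by
  rw [planeWave, planeWave, planeWave, dotProduct_add, ← Complex.exp_add]
  congr 1
  push_cast
  ring

theorem planeWave_ne_zero (p : Momentum) (y : Fin 2 → ℝ) : planeWave L p y ≠ 0 :=
  Complex.exp_ne_zero _

theorem planeWave_sub (p : Momentum) (y z : Fin 2 → ℝ) :
    planeWave L p (y - z) = planeWave L p y / planeWave L p z := by
  rw [eq_div_iff (planeWave_ne_zero p z), ← planeWave_add, sub_add_cancel]

theorem star_planeWave_mul_self (p : Momentum) (y : Fin 2 → ℝ) :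
    star (planeWave L p y) * planeWave L p y = 1 := by
  rw [star_planeWave, ← planeWave_add, neg_add_cancel, planeWave, dotProduct_zero,
    Complex.ofReal_zero, mul_zero, neg_zero, Complex.exp_zero]

theorem sqrt_three_mul_self : √3 * √3 = (3 : ℝ) := Real.mul_self_sqrt (by norm_num)

theorem planar_dotProduct_a₁ (p : Momentum) : planar L p ⬝ᵥ a₁ = 2 * Real.pi * p.1.1 / L := by
  simp only [planar, b₁, b₂, a₁, dotProduct, Fin.sum_univ_two, Matrix.cons_val_zero,
    Matrix.cons_val_one, Pi.add_apply, Pi.smul_apply, smul_eq_mul]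
  linear_combination (Real.pi / 3 * ((p.1.1 : ℝ) / L - (p.1.2.1 : ℝ) / L)) * sqrt_three_mul_self

theorem planar_dotProduct_a₂ (p : Momentum) : planar L p ⬝ᵥ a₂ = 2 * Real.pi * p.1.2.1 / L := by
  simp only [planar, b₁, b₂, a₂, dotProduct, Fin.sum_univ_two, Matrix.cons_val_zero,
    Matrix.cons_val_one, Pi.add_apply, Pi.smul_apply, smul_eq_mul]
  linear_combination (-Real.pi / 3 * ((p.1.1 : ℝ) / L - (p.1.2.1 : ℝ) / L)) * sqrt_three_mul_self

variable [NeZero L]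

theorem planeWave_cellPos (p : Momentum) (x : Cell L) :
    planeWave L p (cellPos x) =
      ZMod.stdAddChar (-((p.1.1 : ZMod L) * x.1 + (p.1.2.1 : ZMod L) * x.2)) := by
  have hcast : -((p.1.1 : ZMod L) * x.1 + (p.1.2.1 : ZMod L) * x.2) =
      ((-(p.1.1 * (x.1.val : ℤ) + p.1.2.1 * (x.2.val : ℤ)) : ℤ) : ZMod L) := by
    push_cast
    rw [ZMod.natCast_zmod_val, ZMod.natCast_zmod_val]
  rw [hcast, ZMod.stdAddChar_coe, planeWave, cellPos, dotProduct_add, dotProduct_smul,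
    dotProduct_smul, planar_dotProduct_a₁, planar_dotProduct_a₂, smul_eq_mul, smul_eq_mul]
  congr 1
  push_cast
  ring

theorem planeWave_cellPos_add (p : Momentum) (x y : Cell L) :
    planeWave L p (cellPos (x + y)) = planeWave L p (cellPos x) * planeWave L p (cellPos y) := by
  rw [planeWave_cellPos, planeWave_cellPos, planeWave_cellPos, ← AddChar.map_add_eq_mul]
  congr 1
  simp only [Prod.fst_add, Prod.snd_add]
  ring

theorem planeWave_a₂ (p : Momentum) :
    planeWave L p a₂ = planeWave L p (cellPos ((0, 1) : Cell L)) := by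
  have hcast : -((p.1.1 : ZMod L) * 0 + (p.1.2.1 : ZMod L) * 1) = ((-p.1.2.1 : ℤ) : ZMod L) := by
    push_cast
    ring
  rw [planeWave_cellPos, hcast, ZMod.stdAddChar_coe, planeWave, planar_dotProduct_a₂]
  congr 1
  push_cast
  ring

theorem planeWave_cellPos_sub_add_δ (p : Momentum) (x : Cell L) :
    planeWave L p (cellPos (x - (0, 1)) + δ 0) = planeWave L p (cellPos x + δ 1) := by
  have hδ : δ 0 = a₂ + δ 1 := by
    ext k
    fin_cases k <;> norm_num [δ, a₂]
  rw [hδ, planeWave_add, planeWave_add, planeWave_add, planeWave_a₂, ← mul_assoc,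
    ← planeWave_cellPos_add, sub_add_cancel]

end PlaneWaves

section Rotation

/-- The rotation by `2π/3` of the plane. -/
def rotatePlane (v : Fin 2 → ℝ) : Fin 2 → ℝ :=
  ![-(1 / 2) * v 0 - √3 / 2 * v 1, √3 / 2 * v 0 - 1 / 2 * v 1]

/-- The rotation by `2π/3` around the third axis, on complex vectors. -/
def rotate (v : Fin 3 → ℂ) : Fin 3 → ℂ :=
  ![-(1 / 2) * v 0 - (√3 : ℝ) / 2 * v 1, (√3 : ℝ) / 2 * v 0 - 1 / 2 * v 1, v 2]

theorem rotatePlane_dotProduct_rotatePlane (v u : Fin 2 → ℝ) :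
    rotatePlane v ⬝ᵥ rotatePlane u = v ⬝ᵥ u := by
  simp only [rotatePlane, dotProduct, Fin.sum_univ_two, Matrix.cons_val_zero, Matrix.cons_val_one]
  linear_combination (1 / 4 * (v 0 * u 0 + v 1 * u 1)) * sqrt_three_mul_self

theorem δ_add_one (i : Fin 3) : δ (i + 1) = rotatePlane (δ i) := by
  ext k
  fin_cases i <;> fin_cases k <;> simp [δ, rotatePlane] <;> linarith [sqrt_three_mul_self]

theorem ofReal_sqrt_three_mul_self : ((√3 : ℝ) : ℂ) * ((√3 : ℝ) : ℂ) = 3 := by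
  rw [← Complex.ofReal_mul, sqrt_three_mul_self, Complex.ofReal_ofNat]

theorem rotate_dotProduct_rotate (v u : Fin 3 → ℂ) : rotate v ⬝ᵥ rotate u = v ⬝ᵥ u := by
  simp only [rotate, dotProduct, Fin.sum_univ_three, Matrix.cons_val_zero, Matrix.cons_val_one,
    Matrix.cons_val]
  linear_combination (1 / 4 * (v 0 * u 0 + v 1 * u 1)) * ofReal_sqrt_three_mul_self

theorem star_rotate (v : Fin 3 → ℂ) : star (rotate v) = rotate (star v) := by
  ext k
  fin_cases k <;> simp [rotate]

theorem δ_dotProduct_rotate (i : Fin 3) (v : Fin 3 → ℂ) :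
    (δ (i + 1) 0 : ℂ) * rotate v 0 + (δ (i + 1) 1 : ℂ) * rotate v 1 =
      (δ i 0 : ℂ) * v 0 + (δ i 1 : ℂ) * v 1 := by
  simp only [δ_add_one, rotatePlane, rotate, Matrix.cons_val_zero, Matrix.cons_val_one]
  push_cast
  linear_combination (1 / 4 * (δ i 0 * v 0 + δ i 1 * v 1)) * ofReal_sqrt_three_mul_self

/-- The rotation by `2π/3` on momentum labels. -/
def rotateMomentum : Momentum ≃ Momentum :=
  Equiv.subtypeEquiv
    { toFun := fun n => (n.2.1 - n.1, -n.1, n.2.2)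
      invFun := fun n => (-n.2.1, n.1 - n.2.1, n.2.2)
      left_inv := fun n => by ext <;> simp
      right_inv := fun n => by ext <;> simp }
    (by
      rintro ⟨a, b, c⟩
      simp only [ne_eq, Prod.mk_eq_zero, Equiv.coe_fn_mk, not_iff_not]
      omega)

theorem rotateMomentum_val (p : Momentum) :
    (rotateMomentum p).1 = (p.1.2.1 - p.1.1, -p.1.1, p.1.2.2) := rfl

theorem planar_rotateMomentum (L : ℕ) (p : Momentum) :
    planar L (rotateMomentum p) = rotatePlane (planar L p) := by
  ext k
  fin_cases k <;>
    simp only [planar, b₁, b₂, rotatePlane, rotateMomentum_val, Fin.zero_eta, Fin.mk_one,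
      Pi.add_apply, Pi.smul_apply, smul_eq_mul, Matrix.cons_val_zero, Matrix.cons_val_one] <;>
    push_cast
  · linear_combination (Real.pi / 3 * ((p.1.1 : ℝ) / L - (p.1.2.1 : ℝ) / L)) * sqrt_three_mul_self
  · ring

theorem absMomentum_rotateMomentum (L : ℕ) (p : Momentum) :
    absMomentum L (rotateMomentum p) = absMomentum L p := by
  rw [absMomentum, absMomentum, momentum_dotProduct_self, momentum_dotProduct_self,
    rotateMomentum_val]
  congr 2
  push_cast
  ring

theorem momentum_rotateMomentum (L : ℕ) (p : Momentum) :
    (fun k => (momentum L (rotateMomentum p) k : ℂ)) =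
      rotate fun k => (momentum L p k : ℂ) := by
  ext k
  fin_cases k <;> simp [momentum, planar_rotateMomentum, rotate, rotatePlane, rotateMomentum_val]

theorem planeWave_rotateMomentum_smul_δ (L : ℕ) (p : Momentum) (i : Fin 3) (s : ℝ) :
    planeWave L (rotateMomentum p) (s • δ (i + 1)) = planeWave L p (s • δ i) := by
  rw [planeWave, planeWave, dotProduct_smul, dotProduct_smul, planar_rotateMomentum, δ_add_one,
    rotatePlane_dotProduct_rotatePlane]

/-- The rotation by `2π/3` around an `A` site, on the cells of the `A` sublattice. -/
def rotateCell {L : ℕ} : Cell L ≃ Cell L where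
  toFun x := (x.2, -x.1 - x.2)
  invFun x := (-x.1 - x.2, x.1)
  left_inv x := Prod.ext (show -x.2 - (-x.1 - x.2) = x.1 by ring) rfl
  right_inv x := Prod.ext rfl (show -(-x.1 - x.2) - x.1 = x.2 by ring)

/-- The rotation by `2π/3` around an `A` site, on the cells of the `B` sublattice: it maps the
bonds of direction `δ₁` to bonds of direction `δ₂ = δ₁ - a₂`. -/
def rotateCellB {L : ℕ} : Cell L ≃ Cell L := rotateCell.trans (Equiv.subRight (0, 1))

theorem rotateCellB_neighbourCell {L : ℕ} (x : Cell L) (i : Fin 3) :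
    rotateCellB (neighbourCell x i) = neighbourCell (rotateCell x) (i + 1) := by
  fin_cases i <;> simp [neighbourCell, rotateCell, rotateCellB, Prod.ext_iff] <;> ring

variable {L : ℕ} [NeZero L]

theorem planeWave_rotateCell (p : Momentum) (x : Cell L) :
    planeWave L (rotateMomentum p) (cellPos (rotateCell x)) = planeWave L p (cellPos x) := by
  rw [planeWave_cellPos, planeWave_cellPos, rotateMomentum_val]
  congr 1
  simp only [rotateCell, Equiv.coe_fn_mk]
  push_cast
  ring

theorem sitePos_one {L : ℕ} (x : Cell L) : sitePos (1, x) = cellPos x + δ 0 := rfl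

theorem planeWave_rotate_sitePos (p : Momentum) :
    ∀ s : Site L, planeWave L (rotateMomentum p) (sitePos (siteEquiv rotateCell rotateCellB s)) =
      planeWave L p (sitePos s) := by
  have hδ := planeWave_rotateMomentum_smul_δ L p 0 1
  rw [one_smul, one_smul, zero_add] at hδ
  refine Prod.forall.2 (Fin.forall_fin_two.2 ⟨planeWave_rotateCell p, fun x => ?_⟩)
  rw [siteEquiv_one, sitePos_one, sitePos_one, rotateCellB, Equiv.trans_apply,
    Equiv.subRight_apply, planeWave_cellPos_sub_add_δ, planeWave_add, planeWave_add,
    planeWave_rotateCell, hδ]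

theorem planeWave_translate_sitePos (p : Momentum) (d : Cell L) :
    ∀ s : Site L, planeWave L p (sitePos (siteEquiv (.addRight d) (.addRight d) s)) =
      planeWave L p (cellPos d) * planeWave L p (sitePos s) := by
  have hcell : ∀ x : Cell L, planeWave L p (cellPos (x + d)) =
      planeWave L p (cellPos d) * planeWave L p (cellPos x) := fun x => by
    rw [planeWave_cellPos_add, mul_comm]
  refine Prod.forall.2 (Fin.forall_fin_two.2 ⟨hcell, fun x => ?_⟩)
  rw [siteEquiv_one, sitePos_one, sitePos_one, Equiv.coe_addRight, planeWave_add, planeWave_add,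
    hcell, mul_assoc]

end Rotation

section Symmetries

namespace Model

variable {L : ℕ} (m : Model L)

theorem fieldCoeff_eq (x : Cell L) (i : Fin 3) (p : Momentum) (r : Fin 2) :
    m.fieldCoeff x i p r =
      ((1 / (area L * L) * √(m.cutoff (absMomentum L p) / (2 * absMomentum L p)) : ℝ) : ℂ) *
        (((δ i 0 : ℂ) * m.ε p r 0 + (δ i 1 : ℂ) * m.ε p r 1) * (planeWave L p (cellPos x) *
          ∫ s in (0 : ℝ)..1, planeWave L p (s • δ i))) := by
  have hfactor : (∫ s in (0 : ℝ)..1, planeWave L p (cellPos x + s • δ i)) =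
      planeWave L p (cellPos x) * ∫ s in (0 : ℝ)..1, planeWave L p (s • δ i) := by
    simp only [planeWave_add, intervalIntegral.integral_const_mul]
  rw [← hfactor, ← intervalIntegral.integral_const_mul]
  rfl

theorem coulomb_eq_of_planeWave (σ : Momentum ≃ Momentum)
    (hσ : ∀ p, absMomentum L (σ p) = absMomentum L p) {y y' : Fin 2 → ℝ}
    (h : ∀ p, planeWave L (σ p) y' = planeWave L p y) : m.coulomb y' = m.coulomb y := by
  rw [Model.coulomb, Model.coulomb, ← finsum_comp_equiv σ]
  congr 1
  refine finsum_congr fun p => ?_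
  rw [hσ]
  exact congrArg _ (h p)

variable [NeZero L]

theorem exists_polarization_rotation (p : Momentum) :
    ∃ w : Matrix.unitaryGroup (Fin 2) ℂ,
      ∀ r, m.ε (rotateMomentum p) r = ∑ r', w r r' • rotate (m.ε p r') := by
  set q : Fin 3 → ℂ := fun k => (momentum L (rotateMomentum p) k : ℂ) with hq
  have hq_ne : q ≠ 0 := by
    intro h
    have hmomentum : momentum L (rotateMomentum p) = 0 :=
      funext fun k => Complex.ofReal_eq_zero.1 (congrFun h k)
    have hpos := absMomentum_pos (L := L) (rotateMomentum p)
    rw [absMomentum, hmomentum, dotProduct_zero, Real.sqrt_zero] at hpos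
    exact hpos.false
  have hq_real : star q = q := funext fun k => Complex.conj_ofReal _
  refine exists_polarization_change hq_ne (fun r r' => ?_) (m.ε_orthonormal _) (fun r => ?_)
    (fun r => ?_)
  · rw [star_rotate, rotate_dotProduct_rotate, m.ε_orthonormal]
  · rw [hq_real, hq, momentum_rotateMomentum, rotate_dotProduct_rotate, m.ε_transverse]
  · rw [hq_real, m.ε_transverse]

/-- The translation by `d`, which multiplies the polarizations by a phase. -/
def translation (d : Cell L) : m.Symmetry where
  cellA := Equiv.addRight d
  cellB := Equiv.addRight d
  dir := Equiv.refl _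
  mom := Equiv.refl _
  pol p := ⟨planeWave L p (cellPos d) • 1, Matrix.mem_unitaryGroup_iff'.2 (by
    rw [star_smul, star_one, smul_mul_smul_comm, star_planeWave_mul_self, one_mul, one_smul])⟩
  cellB_neighbour x i := by
    fin_cases i <;> simp [neighbourCell, Prod.ext_iff] <;> ring
  absMomentum_mom _ := rfl
  fieldCoeff_mom x i p r := by
    simp only [Equiv.coe_addRight, Equiv.refl_apply, Matrix.smul_apply, Matrix.one_apply,
      smul_eq_mul, mul_ite, mul_one, mul_zero, ite_mul, zero_mul, Finset.sum_ite_eq,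
      Finset.mem_univ, if_true, m.fieldCoeff_eq, planeWave_cellPos_add]
    ring
  coulomb_site s s' := m.coulomb_eq_of_planeWave (Equiv.refl _) (fun _ => rfl) fun p => by
    rw [Equiv.refl_apply, planeWave_sub, planeWave_sub, planeWave_translate_sitePos,
      planeWave_translate_sitePos, mul_div_mul_left _ _ (planeWave_ne_zero p _)]

theorem fieldCoeff_rotate {p : Momentum} {w : Matrix.unitaryGroup (Fin 2) ℂ}
    (hw : ∀ r, m.ε (rotateMomentum p) r = ∑ r', w r r' • rotate (m.ε p r')) (x : Cell L)
    (i : Fin 3) (r : Fin 2) :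
    m.fieldCoeff (rotateCell x) (i + 1) (rotateMomentum p) r =
      ∑ r', w r r' * m.fieldCoeff x i p r' := by
  have hpol : (δ (i + 1) 0 : ℂ) * m.ε (rotateMomentum p) r 0 +
      (δ (i + 1) 1 : ℂ) * m.ε (rotateMomentum p) r 1 =
      ∑ r', w r r' * ((δ i 0 : ℂ) * m.ε p r' 0 + (δ i 1 : ℂ) * m.ε p r' 1) := by
    rw [hw r]
    simp only [Fin.sum_univ_two, Pi.add_apply, Pi.smul_apply, smul_eq_mul]
    linear_combination w r 0 * δ_dotProduct_rotate i (m.ε p 0) +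
      w r 1 * δ_dotProduct_rotate i (m.ε p 1)
  simp only [m.fieldCoeff_eq, hpol, absMomentum_rotateMomentum, planeWave_rotateCell,
    planeWave_rotateMomentum_smul_δ, Fin.sum_univ_two]
  ring

/-- The rotation by `2π/3` around an `A` site. -/
def rotation : m.Symmetry where
  cellA := rotateCell
  cellB := rotateCellB
  dir := Equiv.addRight 1
  mom := rotateMomentum
  pol p := (m.exists_polarization_rotation p).choose
  cellB_neighbour := rotateCellB_neighbourCell
  absMomentum_mom := absMomentum_rotateMomentum L
  fieldCoeff_mom x i p := m.fieldCoeff_rotate (m.exists_polarization_rotation p).choose_spec x i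
  coulomb_site s s' := m.coulomb_eq_of_planeWave rotateMomentum (absMomentum_rotateMomentum L)
    fun p => by
      rw [planeWave_sub, planeWave_sub, planeWave_rotate_sitePos, planeWave_rotate_sitePos]

end Model

end Symmetries

section KekuleClass

variable {L : ℕ}

/-- The class of the bond `(x, i)` in the Kekulé pattern with label `j`: the distortion singles
out the bonds of class zero. -/
def kekuleClass (hL : 3 ∣ L) (j : Fin 3) (x : Cell L) (i : Fin 3) : ZMod 3 :=
  ((i : ℕ) : ZMod 3) - ((j : ℕ) : ZMod 3) -
    (ZMod.castHom hL (ZMod 3) x.1 - ZMod.castHom hL (ZMod 3) x.2)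

theorem three_eq_zero_zmod_three : (3 : ZMod 3) = 0 := rfl

theorem natCast_val_add (i j : Fin 3) :
    (((i + j : Fin 3) : ℕ) : ZMod 3) = (i : ℕ) + (j : ℕ) := by
  revert i j
  decide

theorem exists_fin_natCast_eq (c : ZMod 3) : ∃ j : Fin 3, ((j : ℕ) : ZMod 3) = c :=
  ⟨⟨c.val, c.val_lt⟩, ZMod.natCast_zmod_val c⟩

theorem exists_kekuleClass_eq (hL : 3 ∣ L) (j : Fin 3) (x : Cell L) (c : ZMod 3) :
    ∃ i, kekuleClass hL j x i = c := by
  obtain ⟨i, hi⟩ := exists_fin_natCast_eq (c + (j : ℕ) +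
    (ZMod.castHom hL (ZMod 3) x.1 - ZMod.castHom hL (ZMod 3) x.2))
  refine ⟨i, ?_⟩
  rw [kekuleClass, hi]
  ring

theorem cos_two_pi_div_three : Real.cos (2 * Real.pi / 3) = -(1 / 2) := by
  rw [show 2 * Real.pi / 3 = Real.pi - Real.pi / 3 by ring, Real.cos_pi_sub,
    Real.cos_pi_div_three]

theorem sin_two_pi_div_three : Real.sin (2 * Real.pi / 3) = √3 / 2 := by
  rw [show 2 * Real.pi / 3 = Real.pi - Real.pi / 3 by ring, Real.sin_pi_sub,
    Real.sin_pi_div_three]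

theorem cos_int_mul_two_pi_div_three (k : ℤ) :
    Real.cos (k * (2 * Real.pi / 3)) = if (k : ZMod 3) = 0 then 1 else -(1 / 2) := by
  have hzero : (k : ZMod 3) = 0 ↔ k % 3 = 0 := by
    rw [ZMod.intCast_zmod_eq_zero_iff_dvd]
    exact Int.dvd_iff_emod_eq_zero
  have hdiv : (k : ℝ) * (2 * Real.pi / 3) =
      ((k % 3 : ℤ) : ℝ) * (2 * Real.pi / 3) + ((k / 3 : ℤ) : ℝ) * (2 * Real.pi) := by
    have hk : (k : ℝ) = ((k % 3 : ℤ) : ℝ) + 3 * ((k / 3 : ℤ) : ℝ) := by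
      exact_mod_cast (Int.emod_add_mul_ediv k 3).symm
    rw [hk]
    ring
  rw [hdiv, Real.cos_add_int_mul_two_pi]
  simp only [hzero]
  obtain h | h | h : k % 3 = 0 ∨ k % 3 = 1 ∨ k % 3 = 2 := by lia
  · rw [h, if_pos rfl, Int.cast_zero, zero_mul, Real.cos_zero]
  · rw [h, if_neg one_ne_zero, Int.cast_one, one_mul, cos_two_pi_div_three]
  · rw [h, if_neg two_ne_zero, show ((2 : ℤ) : ℝ) * (2 * Real.pi / 3) =
      2 * Real.pi - 2 * Real.pi / 3 by push_cast; ring, Real.cos_two_pi_sub,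
      cos_two_pi_div_three]

theorem pF_dotProduct_cellPos (x : Cell L) :
    pF ⬝ᵥ cellPos x = (2 * x.1.val + x.2.val) * (2 * Real.pi / 3) := by
  have sqrt_three_ne_zero : √3 ≠ 0 := by positivity
  simp only [pF, cellPos, a₁, a₂, dotProduct, Fin.sum_univ_two, Matrix.cons_val_zero,
    Matrix.cons_val_one, Pi.add_apply, Pi.smul_apply, smul_eq_mul]
  field_simp
  ring

theorem pF_dotProduct_δ (i : Fin 3) : pF ⬝ᵥ δ i = (1 - (i : ℕ)) * (2 * Real.pi / 3) := by
  have sqrt_three_ne_zero : √3 ≠ 0 := by positivity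
  fin_cases i <;>
    simp only [pF, δ, dotProduct, Fin.sum_univ_two, Fin.zero_eta, Fin.mk_one, Fin.reduceFinMk,
      Matrix.cons_val_zero, Matrix.cons_val_one, Matrix.cons_val] <;>
    field_simp <;>
    norm_num

variable [NeZero L]

theorem kekuleClass_eq_intCast (hL : 3 ∣ L) (j : Fin 3) (x : Cell L) (i : Fin 3) :
    kekuleClass hL j x i = (((i : ℕ) - (j : ℕ) + (2 * x.1.val + x.2.val) : ℤ) : ZMod 3) := by
  rw [kekuleClass, ZMod.castHom_apply, ZMod.castHom_apply, ← ZMod.natCast_val, ← ZMod.natCast_val]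
  push_cast
  linear_combination (-(x.1.val : ZMod 3)) * three_eq_zero_zmod_three

theorem kekule_eq (hL : 3 ∣ L) (φ₀ Δ₀ : ℝ) (j : Fin 3) (x : Cell L) (i : Fin 3) :
    kekule φ₀ Δ₀ j x i =
      φ₀ + 2 / 3 * Δ₀ * if kekuleClass hL j x i = 0 then 1 else -(1 / 2) := by
  have hphase : pF ⬝ᵥ (δ i - δ j - cellPos x) =
      -((((i : ℕ) - (j : ℕ) + (2 * x.1.val + x.2.val) : ℤ) : ℝ) * (2 * Real.pi / 3)) := by
    rw [dotProduct_sub, dotProduct_sub, pF_dotProduct_δ, pF_dotProduct_δ, pF_dotProduct_cellPos]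
    push_cast
    ring
  rw [kekule, hphase, Real.cos_neg, cos_int_mul_two_pi_div_three, kekuleClass_eq_intCast]

theorem exp_pF_dotProduct_cellPos (hL : 3 ∣ L) (x : Cell L) :
    Complex.exp (Complex.I * ((pF ⬝ᵥ cellPos x : ℝ) : ℂ)) =
      ZMod.stdAddChar (kekuleClass hL 0 x 0) := by
  rw [kekuleClass_eq_intCast, ZMod.stdAddChar_coe, pF_dotProduct_cellPos]
  congr 1
  push_cast
  ring

theorem sum_comp_kekuleClass (hL : 3 ∣ L) (h : ZMod 3 → ℂ) :
    ∑ x : Cell L, h (kekuleClass hL 0 x 0) = (Fintype.card (Cell L) : ℂ) / 3 * ∑ c, h c := by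
  have hshift : ∀ c : ZMod 3, ∑ x : Cell L, h (kekuleClass hL 0 x 0) =
      ∑ x : Cell L, h (kekuleClass hL 0 x 0 + c) := by
    intro c
    rw [← Equiv.sum_comp (Equiv.addRight ((0, (c.val : ZMod L)) : Cell L))]
    refine Finset.sum_congr rfl fun x _ => congrArg h ?_
    simp only [kekuleClass, Equiv.coe_addRight, Prod.fst_add, Prod.snd_add, map_add, map_natCast,
      add_zero, ZMod.natCast_zmod_val]
    ring
  have hdouble : ∑ _c : ZMod 3, ∑ x : Cell L, h (kekuleClass hL 0 x 0) =
      ∑ _x : Cell L, ∑ c : ZMod 3, h c := by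
    rw [Finset.sum_congr rfl fun c _ => hshift c, Finset.sum_comm]
    exact Finset.sum_congr rfl fun x _ => Equiv.sum_comp (Equiv.addLeft (kekuleClass hL 0 x 0)) h
  rw [Finset.sum_const, Finset.sum_const, nsmul_eq_mul, nsmul_eq_mul, Finset.card_univ,
    Finset.card_univ, ZMod.card, Nat.cast_ofNat] at hdouble
  linear_combination hdouble / 3

end KekuleClass

section KekuleAverages

namespace Model

variable {L : ℕ} [NeZero L] (hL : 3 ∣ L) (m : Model L) (β φ₀ Δ₀ : ℝ)
include hL

theorem Symmetry.average_kekule {m : Model L} (Y : m.Symmetry) {j j' : Fin 3}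
    (h : ∀ x i, kekuleClass hL j' (Y.cellA x) (Y.dir i) = kekuleClass hL j x i)
    (x : Cell L) (i : Fin 3) :
    m.average β (kekule φ₀ Δ₀ j') (m.bondOp (Y.cellA x) (Y.dir i)) =
      m.average β (kekule φ₀ Δ₀ j) (m.bondOp x i) :=
  Y.average_bondOp β (fun x i => by rw [kekule_eq hL, kekule_eq hL, h]) x i

theorem average_kekule_translate {j j' : Fin 3} (x : Cell L) (i : Fin 3)
    (h : ((j' : ℕ) : ZMod 3) = ((j : ℕ) : ZMod 3) +
      (ZMod.castHom hL (ZMod 3) x.1 - ZMod.castHom hL (ZMod 3) x.2)) :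
    m.average β (kekule φ₀ Δ₀ j) (m.bondOp x i) =
      m.average β (kekule φ₀ Δ₀ j') (m.bondOp 0 i) := by
  have hclass : ∀ y k, kekuleClass hL j ((m.translation x).cellA y) ((m.translation x).dir k) =
      kekuleClass hL j' y k := fun y k => by
    simp only [translation, kekuleClass, Equiv.coe_addRight, Equiv.refl_apply, Prod.fst_add,
      Prod.snd_add, map_add, h]
    ring
  rw [← (m.translation x).average_kekule hL β φ₀ Δ₀ hclass 0 i]
  simp only [translation, Equiv.coe_addRight, zero_add, Equiv.refl_apply]

theorem average_kekule_rotate (j i : Fin 3) :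
    m.average β (kekule φ₀ Δ₀ (j + 1)) (m.bondOp 0 (i + 1)) =
      m.average β (kekule φ₀ Δ₀ j) (m.bondOp 0 i) := by
  have hclass : ∀ y k, kekuleClass hL (j + 1) (m.rotation.cellA y) (m.rotation.dir k) =
      kekuleClass hL j y k := fun y k => by
    simp only [rotation, rotateCell, kekuleClass, Equiv.coe_addRight, Equiv.coe_fn_mk,
      map_sub, map_neg, natCast_val_add]
    linear_combination (-(ZMod.castHom hL (ZMod 3) y.2)) * three_eq_zero_zmod_three
  have hzero : rotateCell (0 : Cell L) = 0 := by
    simp only [rotateCell, Equiv.coe_fn_mk, Prod.fst_zero, Prod.snd_zero, neg_zero, sub_zero,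
      Prod.mk_zero_zero]
  rw [← m.rotation.average_kekule hL β φ₀ Δ₀ hclass 0 i]
  simp only [rotation, hzero, Equiv.coe_addRight]

theorem average_kekule_eq_of_kekuleClass {j j' : Fin 3} (x : Cell L) (i : Fin 3)
    (h : kekuleClass hL j x i = -((j' : ℕ) : ZMod 3)) :
    m.average β (kekule φ₀ Δ₀ j) (m.bondOp x i) =
      m.average β (kekule φ₀ Δ₀ j') (m.bondOp 0 0) := by
  have hrotate : m.average β (kekule φ₀ Δ₀ (j' + i)) (m.bondOp 0 i) =
      m.average β (kekule φ₀ Δ₀ j') (m.bondOp 0 0) := by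
    have hone := m.average_kekule_rotate hL β φ₀ Δ₀ j' 0
    have htwo := m.average_kekule_rotate hL β φ₀ Δ₀ (j' + 1) 1
    rw [add_assoc] at htwo
    fin_cases i
    · exact congrArg (fun k => m.average β (kekule φ₀ Δ₀ k) (m.bondOp 0 0)) (add_zero j')
    · exact hone
    · exact htwo.trans hone
  rw [← hrotate]
  refine m.average_kekule_translate hL β φ₀ Δ₀ x i ?_
  rw [kekuleClass] at h
  rw [natCast_val_add]
  linear_combination h

theorem exists_average_kekule_eq : ∃ f : ZMod 3 → ℝ, ∀ j x i,
    m.average β (kekule φ₀ Δ₀ j) (m.bondOp x i) = (f (kekuleClass hL j x i) : ℂ) := by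
  choose J hJ using exists_fin_natCast_eq
  refine ⟨fun c => (m.average β (kekule φ₀ Δ₀ (J (-c))) (m.bondOp 0 0)).re, fun j x i => ?_⟩
  rw [m.average_kekule_eq_of_kekuleClass hL β φ₀ Δ₀ (j' := J (-kekuleClass hL j x i)) x i
    (by rw [hJ, neg_neg])]
  exact (Complex.conj_eq_iff_re.1 (m.conj_average_bondOp β _ 0 0)).symm

variable {m β φ₀ Δ₀}

theorem gapEquation_kekule_iff {f : ZMod 3 → ℝ} {j : Fin 3}
    (hf : ∀ x i, m.average β (kekule φ₀ Δ₀ j) (m.bondOp x i) = (f (kekuleClass hL j x i) : ℂ))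
    (g κ : ℝ) :
    m.GapEquation β g κ (kekule φ₀ Δ₀ j) ↔
      ∀ c, φ₀ + 2 / 3 * Δ₀ * (if c = 0 then 1 else -(1 / 2)) = g ^ 2 / κ * f c := by
  simp only [GapEquation, hf, kekule_eq hL, ← Complex.ofReal_mul, Complex.ofReal_inj]
  refine ⟨fun h c => ?_, fun h x i => h _⟩
  obtain ⟨i, rfl⟩ := exists_kekuleClass_eq hL j 0 c
  exact h 0 i

theorem average_bondOpHat_zero (hβ : 0 < β) {f : ZMod 3 → ℝ} {φ : Cell L → Fin 3 → ℝ}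
    (hf : ∀ x, m.average β φ (m.bondOp x 0) = (f (kekuleClass hL 0 x 0) : ℂ)) :
    m.average β φ (m.bondOpHat 0 0) = (Fintype.card (Cell L) : ℂ) / 3 * ∑ c, (f c : ℂ) := by
  rw [bondOpHat, m.average_sum_smul hβ, ← sum_comp_kekuleClass hL]
  simp only [hf, zero_dotProduct, Complex.ofReal_zero, mul_zero, Complex.exp_zero, one_mul]

theorem average_bondOpHat_pF (hβ : 0 < β) {f : ZMod 3 → ℝ} {φ : Cell L → Fin 3 → ℝ}
    (hf : ∀ x, m.average β φ (m.bondOp x 0) = (f (kekuleClass hL 0 x 0) : ℂ)) :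
    m.average β φ (m.bondOpHat pF 0) =
      (Fintype.card (Cell L) : ℂ) / 3 * ∑ c, ZMod.stdAddChar c * (f c : ℂ) := by
  rw [bondOpHat, m.average_sum_smul hβ, ← sum_comp_kekuleClass hL]
  simp only [hf, exp_pF_dotProduct_cellPos hL]

end Model

end KekuleAverages

section ThreePointFourier

theorem stdAddChar_zmod_three_one : ZMod.stdAddChar (1 : ZMod 3) = ⟨-(1 / 2), √3 / 2⟩ := by
  have hangle : 2 * Real.pi * Complex.I * ((1 : ℤ) : ℂ) / ((3 : ℕ) : ℂ) =
      ((2 * Real.pi / 3 : ℝ) : ℂ) * Complex.I := by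
    push_cast
    ring
  rw [show (1 : ZMod 3) = ((1 : ℤ) : ZMod 3) from Int.cast_one.symm, ZMod.stdAddChar_coe, hangle]
  refine Complex.ext ?_ ?_
  · rw [Complex.exp_ofReal_mul_I_re, cos_two_pi_div_three]
  · rw [Complex.exp_ofReal_mul_I_im, sin_two_pi_div_three]

theorem stdAddChar_zmod_three_two : ZMod.stdAddChar (2 : ZMod 3) = ⟨-(1 / 2), -(√3 / 2)⟩ := by
  rw [show (2 : ZMod 3) = -1 from rfl, AddChar.map_neg_eq_conj, stdAddChar_zmod_three_one]
  rfl

theorem sum_zmod_three {A : Type*} [AddCommMonoid A] (F : ZMod 3 → A) :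
    ∑ c, F c = F 0 + F 1 + F 2 :=
  Fin.sum_univ_three F

theorem sum_stdAddChar_mul_zmod_three (u : ZMod 3 → ℝ) :
    ∑ c, ZMod.stdAddChar c * (u c : ℂ) =
      ⟨u 0 - (u 1 + u 2) / 2, √3 / 2 * (u 1 - u 2)⟩ := by
  rw [sum_zmod_three, AddChar.map_zero_eq_one, stdAddChar_zmod_three_one,
    stdAddChar_zmod_three_two]
  refine Complex.ext ?_ ?_ <;>
    simp only [Complex.add_re, Complex.add_im, Complex.re_mul_ofReal, Complex.im_mul_ofReal,
      Complex.one_re, Complex.one_im] <;>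
    ring

theorem kekule_profile_iff (φ₀ Δ₀ : ℝ) (u : ZMod 3 → ℝ) :
    (∀ c, φ₀ + 2 / 3 * Δ₀ * (if c = 0 then 1 else -(1 / 2)) = u c) ↔
      φ₀ + 2 / 3 * Δ₀ = u 0 ∧ φ₀ - 1 / 3 * Δ₀ = u 1 ∧ φ₀ - 1 / 3 * Δ₀ = u 2 := by
  have hcases : ∀ c : ZMod 3, c = 0 ∨ c = 1 ∨ c = 2 := by decide
  have hone : (1 : ZMod 3) ≠ 0 := by decide
  have htwo : (2 : ZMod 3) ≠ 0 := by decide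
  refine ⟨fun h => ⟨?_, ?_, ?_⟩, ?_⟩
  · rw [← h 0, if_pos rfl, mul_one]
  · rw [← h 1, if_neg hone]
    ring
  · rw [← h 2, if_neg htwo]
    ring
  · rintro ⟨h0, h1, h2⟩ c
    obtain rfl | rfl | rfl := hcases c
    · rw [if_pos rfl, mul_one, h0]
    · rw [if_neg hone, ← h1]
      ring
    · rw [if_neg htwo, ← h2]
      ring

theorem kekule_profile_iff_fourier (φ₀ Δ₀ : ℝ) (u : ZMod 3 → ℝ) :
    (∀ c, φ₀ + 2 / 3 * Δ₀ * (if c = 0 then 1 else -(1 / 2)) = u c) ↔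
      ((φ₀ : ℂ) = 1 / 3 * ∑ c, (u c : ℂ) ∧
        ((Δ₀ / 3 : ℝ) : ℂ) = 1 / 3 * ∑ c, ZMod.stdAddChar c * (u c : ℂ)) := by
  have hmean : (φ₀ : ℂ) = 1 / 3 * ∑ c, (u c : ℂ) ↔ 3 * φ₀ = u 0 + u 1 + u 2 := by
    rw [sum_zmod_three, one_div, eq_inv_mul_iff_mul_eq₀ three_ne_zero]
    norm_cast
  have hfourier : ((Δ₀ / 3 : ℝ) : ℂ) = 1 / 3 * ∑ c, ZMod.stdAddChar c * (u c : ℂ) ↔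
      Δ₀ = u 0 - (u 1 + u 2) / 2 ∧ u 1 = u 2 := by
    rw [sum_stdAddChar_mul_zmod_three, one_div, eq_inv_mul_iff_mul_eq₀ three_ne_zero,
      Complex.ofReal_div, Complex.ofReal_ofNat, mul_div_cancel₀ _ three_ne_zero,
      Complex.ext_iff, Complex.ofReal_re, Complex.ofReal_im, eq_comm (a := (0 : ℝ)),
      mul_eq_zero, or_iff_right (by positivity), sub_eq_zero]
  rw [kekule_profile_iff, hmean, hfourier]
  constructor
  · rintro ⟨h0, h1, h2⟩
    exact ⟨by linarith, by linarith, by linarith⟩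
  · rintro ⟨hsum, hdiff, heq⟩
    exact ⟨by linarith, by linarith, by linarith⟩

end ThreePointFourier

end Honeycomb

end

theorem mainTheorem6 {L : ℕ} [NeZero L] (hL : 3 ∣ L) (m : Honeycomb.Model L)
    (β : ℝ) (hβ : 0 < β) (g κ : ℝ) (hκ : 0 < κ) (φ₀ Δ₀ : ℝ) (j₀ : Fin 3) :
    m.GapEquation β g κ (Honeycomb.kekule φ₀ Δ₀ j₀) ↔
      ((φ₀ : ℂ) = (g ^ 2 / κ : ℝ) * (1 / (Fintype.card (Honeycomb.Cell L) : ℂ)) *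
          m.average β (Honeycomb.kekule φ₀ Δ₀ 0) (m.bondOpHat 0 0) ∧
        ((Δ₀ / 3 : ℝ) : ℂ) = (g ^ 2 / κ : ℝ) * (1 / (Fintype.card (Honeycomb.Cell L) : ℂ)) *
          m.average β (Honeycomb.kekule φ₀ Δ₀ 0) (m.bondOpHat Honeycomb.pF 0)) := by
  obtain ⟨f, hf⟩ := m.exists_average_kekule_eq hL β φ₀ Δ₀
  have hnormalize : ∀ z : ZMod 3 → ℂ,
      ((g ^ 2 / κ : ℝ) : ℂ) * (1 / (Fintype.card (Honeycomb.Cell L) : ℂ)) *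
        ((Fintype.card (Honeycomb.Cell L) : ℂ) / 3 * ∑ c, z c) =
      1 / 3 * ∑ c, ((g ^ 2 / κ : ℝ) : ℂ) * z c := fun z => by
    have hcard : (Fintype.card (Honeycomb.Cell L) : ℂ) ≠ 0 :=
      Nat.cast_ne_zero.2 Fintype.card_ne_zero
    rw [← Finset.mul_sum]
    field_simp
  rw [Honeycomb.Model.gapEquation_kekule_iff hL (hf j₀), Honeycomb.kekule_profile_iff_fourier,
    Honeycomb.Model.average_bondOpHat_zero hL hβ fun x => hf 0 x 0,
    Honeycomb.Model.average_bondOpHat_pF hL hβ fun x => hf 0 x 0, hnormalize, hnormalize]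
  simp only [Complex.ofReal_mul, mul_left_comm]
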